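/- Let $n\ge 1$ and $k\ge 0$ be integers. In $\mathbb C[y_1,\dots,y_n]^{S_n}=\mathbb C[e_1,\dots,e_n]$ let $e_r$, $h_r$, $p_r$ be the elementary, complete symmetric and power sum polynomials in $y_1,\dots,y_n$, and for $\lambda=(\lambda_1\ge\dots\ge\lambda_n\ge 0)$ let $s_\lambda$ be the Schur polynomial, i.e. the sum of the monomials $\prod_c y_{T(c)}$ over semistandard tableaux $T$ of shape $\lambda$ with entries in $\{1,\dots,n\}$. Let $P_k^+$ be the set of dominant integral weights of level $k$ of $\widehat{\mathfrak{su}}(n)$, i.e. of tuples $\hat\lambda=(m_1,\dots,m_n)\in\mathbb Z_{\ge0}^n$ with $\sum_i m_i=k$; such a weight corresponds to the partition $\lambda$ with $\lambda_i-\lambda_{i+1}=m_i$ for $1\le i\le n-1$ and $\lambda_n=0$. Let $S$ be the matrix over $P_k^+$ given by $$S_{\hat\lambda\hat\sigma}=\frac{e^{i\pi n(n-1)/4}}{\sqrt{n(k+n)^{n-1}}}\sum_{w\in S_n}\operatorname{sgn}(w)\,e^{-\frac{2\pi i}{k+n}(\sigma+\rho,\,w(\lambda+\rho))},$$ where $\rho$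 is the Weyl vector of $\mathfrak{su}(n)$, $\lambda,\sigma$ are viewed as weights of $\mathfrak{su}(n)$, and $(\cdot,\cdot)$ is the standard invariant form. Put $$\mathcal N_{\hat\lambda\hat\mu}^{\hat\nu}=\sum_{\hat\sigma\in P_k^+}\frac{S_{\hat\lambda\hat\sigma}S_{\hat\mu\hat\sigma}S^{-1}_{\hat\nu\hat\sigma}}{S_{\hat\emptyset\hat\sigma}},$$ where $\hat\emptyset$ is the weight of the empty partition. These numbers are integers, and the free abelian group $\mathcal F_{n,k}$ on $P_k^+$ with the product $\hat\lambda*\hat\mu=\sum_{\hat\nu}\mathcal N_{\hat\lambda\hat\mu}^{\hat\nu}\,\hat\nu$ is an associative, commutative ring with unit $\hat\emptyset$ (the fusion ring). Moreover: 1. Let $I_{n,k}=\langle e_n-1,h_{k+1},\dots,h_{n+k-1}\rangle\subset\mathbb C[e_1,\dots,e_n]$. This is the ideal of Gepner's fusion potential $V_{n+k}=\frac1{n+k}\,p_{n+k}$ with the constraint $e_n=1$: $I_{n,k}$ is the ideal generated by $e_n-1$ and the partial derivatives $\partial V_{n+k}/\partial e_i$, $1\le i\le n-1$. 2. $I_{n,k}$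 coincides with the Goodman–Wenzl ideal, generated by $e_n-1$ and all $s_\lambda$ with $\lambda=(\lambda_1\ge\dots\ge\lambda_n\ge0)$ and $\lambda_1-\lambda_n=k+1$. 3. The map $P_k^+\ni\hat\lambda\mapsto s_\lambda+I_{n,k}$ extends to an isomorphism of unital $\mathbb C$-algebras $$\mathcal F_{n,k}\otimes_{\mathbb Z}\mathbb C\;\cong\;\mathbb C[e_1,\dots,e_n]/I_{n,k}.$$ -/

import Mathlib

open scoped TensorProduct

noncomputable section

namespace SuFusion

/-! ### Dominant integral weights of level `k`, partitions, the modular `S`-matrix -/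

/-- `P_k^+`: dominant integral weights of level `k` of affine `su(n)`, given by their Dynkin labels
`(m_1, …, m_n)` with `m_1 + ⋯ + m_n = k`. The label `m_{i+1}` is `m i`; the last one belongs to the
affine node. -/
def Weight (n k : ℕ) : Type := {m : Fin n → ℕ // ∑ i, m i = k}

instance (n k : ℕ) : DecidableEq (Weight n k) :=
  inferInstanceAs (DecidableEq {m : Fin n → ℕ // ∑ i, m i = k})

instance (n k : ℕ) : Fintype (Weight n k) :=
  Fintype.subtype (Finset.Nat.antidiagonalTuple n k)
    (fun _ => Finset.Nat.mem_antidiagonalTuple)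

/-- The partition of a weight, written with `n` parts, the last one being `0`:
`λ_i - λ_{i+1} = m_i` for `1 ≤ i ≤ n - 1` and `λ_n = 0`. -/
def Weight.part {n k : ℕ} (m : Weight n k) (i : Fin n) : ℕ :=
  ∑ j : Fin n, if i ≤ j ∧ (j : ℕ) + 1 < n then m.1 j else 0

/-- The weight of the empty partition: `k` times the fundamental weight of the affine node. -/
def Weight.vac (n k : ℕ) [NeZero n] : Weight n k :=
  ⟨Pi.single ⊤ k, by simp⟩

/-- `λ + ρ`, for the finite part `λ` of a weight, as a vector with `n` coordinates of sum zero;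
there the invariant form is the dot product and the Weyl group `S_n` permutes the coordinates. -/
def Weight.shifted {n k : ℕ} (m : Weight n k) (i : Fin n) : ℝ :=
  ((m.part i : ℝ) - (∑ j, (m.part j : ℝ)) / n) + (((n : ℝ) - 1) / 2 - (i : ℕ))

/-- The modular `S`-matrix, by the Kac–Peterson formula. -/
def modS (n k : ℕ) : Matrix (Weight n k) (Weight n k) ℂ := fun l s =>
  Complex.exp (Complex.I * Real.pi * n * (n - 1) / 4) /
      (Real.sqrt ((n : ℝ) * ((k : ℝ) + n) ^ (n - 1)) : ℝ) *
    ∑ w : Equiv.Perm (Fin n), ((Equiv.Perm.sign w : ℤ) : ℂ) *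
      Complex.exp (-(2 * Real.pi * Complex.I / ((k : ℂ) + n)) *
        ((∑ i, s.shifted i * l.shifted (w i) : ℝ) : ℂ))

/-- The right-hand side of the Verlinde formula. -/
def verlinde (n k : ℕ) [NeZero n] (l m r : Weight n k) : ℂ :=
  ∑ s : Weight n k, modS n k l s * modS n k m s * (modS n k)⁻¹ r s / modS n k (Weight.vac n k) s

/-- The fusion coefficients as integers: the integer nearest to the value of the Verlinde formula.
(That the two agree exactly is part of the theorem.) -/
def fusionCoeff (n k : ℕ) [NeZero n] (l m r : Weight n k) : ℤ := round (verlinde n k l m r).re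

/-! ### The fusion ring -/

/-- The free abelian group on `P_k^+`. -/
def FusionRing (n k : ℕ) : Type := Weight n k →₀ ℤ

instance (n k : ℕ) : AddCommGroup (FusionRing n k) :=
  inferInstanceAs (AddCommGroup (Weight n k →₀ ℤ))

/-- The basis element of a weight. -/
def FusionRing.of {n k : ℕ} (m : Weight n k) : FusionRing n k := Finsupp.single m (1 : ℤ)

/-- The coefficient of an element at a weight. -/
def FusionRing.coeff {n k : ℕ} (x : FusionRing n k) (m : Weight n k) : ℤ :=
  DFunLike.coe (F := Weight n k →₀ ℤ) x m

/-- The fusion product: the bi-additive extension of `l * m = ∑ r, N_{l m}^r r`. -/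
def FusionRing.mul {n k : ℕ} [NeZero n] (x y : FusionRing n k) : FusionRing n k :=
  ∑ l : Weight n k, ∑ m : Weight n k, ∑ r : Weight n k,
    (x.coeff l * y.coeff m * fusionCoeff n k l m r) • FusionRing.of r

instance (n k : ℕ) [NeZero n] : Mul (FusionRing n k) := ⟨FusionRing.mul⟩

instance (n k : ℕ) [NeZero n] : One (FusionRing n k) := ⟨FusionRing.of (Weight.vac n k)⟩

theorem FusionRing.coeff_add {n k : ℕ} (x y : FusionRing n k) (m : Weight n k) :
    (x + y).coeff m = x.coeff m + y.coeff m := rfl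

theorem FusionRing.coeff_zero {n k : ℕ} (m : Weight n k) :
    (0 : FusionRing n k).coeff m = 0 := rfl

instance (n k : ℕ) [NeZero n] : NonUnitalNonAssocRing (FusionRing n k) where
  left_distrib x y z := by
    change FusionRing.mul _ _ = FusionRing.mul _ _ + FusionRing.mul _ _
    simp only [FusionRing.mul, FusionRing.coeff_add, mul_add, add_mul, add_smul,
      Finset.sum_add_distrib]
  right_distrib x y z := by
    change FusionRing.mul _ _ = FusionRing.mul _ _ + FusionRing.mul _ _
    simp only [FusionRing.mul, FusionRing.coeff_add, add_mul, add_smul, Finset.sum_add_distrib]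
  zero_mul x := by
    change FusionRing.mul _ _ = _
    simp [FusionRing.mul, FusionRing.coeff_zero]
  mul_zero x := by
    change FusionRing.mul _ _ = _
    simp [FusionRing.mul, FusionRing.coeff_zero]

/-! ### Symmetric polynomials in `y_1, …, y_n` as elements of `ℂ[e_1, …, e_n]` -/

/-- The polynomial ring `ℂ[e_1, …, e_n]`; the variable `X i` is `e_{i+1}`. -/
abbrev ERing (n : ℕ) : Type := MvPolynomial (Fin n) ℂ

/-- The isomorphism of `ℂ[e_1, …, e_n]` with the symmetric polynomials in `y_1, …, y_n`. -/
abbrev toSym (n : ℕ) : ERing n ≃ₐ[ℂ] MvPolynomial.symmetricSubalgebra (Fin n) ℂ :=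
  MvPolynomial.esymmAlgEquiv (Fin n) ℂ (Fintype.card_fin n)

/-- `e_r` as an element of `ℂ[e_1, …, e_n]`. -/
def e (n r : ℕ) : ERing n :=
  (toSym n).symm ⟨MvPolynomial.esymm (Fin n) ℂ r, MvPolynomial.esymm_isSymmetric _ _ r⟩

/-- The complete symmetric polynomial `h_r` as an element of `ℂ[e_1, …, e_n]`. -/
def h (n r : ℕ) : ERing n :=
  (toSym n).symm ⟨MvPolynomial.hsymm (Fin n) ℂ r, MvPolynomial.hsymm_isSymmetric _ _ r⟩

/-- The power sum `p_r` as an element of `ℂ[e_1, …, e_n]`. -/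
def p (n r : ℕ) : ERing n :=
  (toSym n).symm ⟨MvPolynomial.psum (Fin n) ℂ r, MvPolynomial.psum_isSymmetric _ _ r⟩

/-- A filling of the boxes of the diagram of `lam` (row `i` has `lam i` boxes) with entries in
`{1, …, n}` is a semistandard tableau: rows increase weakly, columns increase strictly. -/
def IsSemistandard {n : ℕ} (lam : Fin n → ℕ) (T : (Σ i : Fin n, Fin (lam i)) → Fin n) : Prop :=
  (∀ (i : Fin n) (a b : Fin (lam i)), a ≤ b → T ⟨i, a⟩ ≤ T ⟨i, b⟩) ∧
  (∀ (i j : Fin n) (a : Fin (lam i)) (b : Fin (lam j)),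
    i < j → (a : ℕ) = (b : ℕ) → T ⟨i, a⟩ < T ⟨j, b⟩)

open Classical in
/-- The Schur polynomial `s_λ(y_1, …, y_n)` as the weighted sum of semistandard tableaux. -/
def schur {n : ℕ} (lam : Fin n → ℕ) : MvPolynomial (Fin n) ℂ :=
  ∑ T : (Σ i : Fin n, Fin (lam i)) → Fin n with IsSemistandard lam T,
    ∏ c : Σ i : Fin n, Fin (lam i), MvPolynomial.X (T c)

/-- `q` is the Schur polynomial `s_λ` written as a polynomial in `e_1, …, e_n`. -/
def IsSchur {n : ℕ} (lam : Fin n → ℕ) (q : ERing n) : Prop :=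
  ((toSym n q : MvPolynomial.symmetricSubalgebra (Fin n) ℂ) : MvPolynomial (Fin n) ℂ) = schur lam

/-! ### The ideals -/

/-- `I_{n,k} = ⟨e_n - 1, h_{k+1}, …, h_{n+k-1}⟩`. -/
def gepnerIdeal (n k : ℕ) : Ideal (ERing n) :=
  Ideal.span (insert (e n n - 1) {q | ∃ r : ℕ, k + 1 ≤ r ∧ r + 1 ≤ n + k ∧ q = h n r})

/-- Gepner's fusion potential `V_{n+k} = p_{n+k} / (n+k)` as a polynomial in `e_1, …, e_n`. -/
def gepnerPotential (n k : ℕ) : ERing n :=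
  MvPolynomial.C (1 / ((n : ℂ) + k)) * p n (n + k)

/-- The ideal resulting from Gepner's potential: it is generated by `e_n - 1` and the partial
derivatives `∂V_{n+k}/∂e_i`, `i = 1, …, n - 1`. -/
def potentialIdeal (n k : ℕ) : Ideal (ERing n) :=
  Ideal.span (insert (e n n - 1)
    {q | ∃ i : Fin n, (i : ℕ) + 1 < n ∧ q = MvPolynomial.pderiv i (gepnerPotential n k)})

/-- The ideal of Goodman and Wenzl (with `e_n = 1`): it is generated by `e_n - 1` and all `s_λ` with
`λ = (λ_1 ≥ ⋯ ≥ λ_n)` and `λ_1 - λ_n = k + 1`. -/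
def goodmanWenzlIdeal (n k : ℕ) [NeZero n] : Ideal (ERing n) :=
  Ideal.span (insert (e n n - 1)
    {q | ∃ lam : Fin n → ℕ, Antitone lam ∧ lam 0 = lam ⊤ + (k + 1) ∧ IsSchur lam q})

end SuFusion

end

/-! Both algebras are the algebra of functions on the finite set `P_k^+`. A weight σ gives the point
y_σ with coordinates exp(-2πi(σ+ρ)_i/(n+k)): n distinct numbers with product 1 and a common (n+k)-th
power. Up to permutation every such fusion point arises from a weight
(`IsFusionPoint.exists_weight`), and I_{n,k} is the vanishing ideal of these points
(`mem_gepnerIdeal_iff`): modulo its extension to ℂ[y] the variables are roots of unity, which forces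
that extension to be a vanishing ideal, and averaging over S_n carries this back to ℂ[e].

On the fusion side, the bialternant formula s_λ a_ρ = a_{λ+ρ} turns the Kac–Peterson sum into
S_{λσ}/S_{∅σ} = s_λ(y_σ). The Verlinde numbers are therefore the structure constants of the
functions σ ↦ s_λ(y_σ), once these are known to form a basis. At a fusion point an alternant does
not change when (n+k)q with Σq = 0 is added to its exponents, so every alternant straightens to 0 or
±a_{μ+ρ} with μ in `P_k^+` (`exists_alternant_eq`). Hence every symmetric polynomial restricts to a
combination of the s_μ, with integral coefficients if its own are integral (`exists_aeval_eq_sum`).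
This gives the integrality of the fusion coefficients and the invertibility of the matrix of values.

For the potential, `cofactorMatrix` is up to signs and order the Jacobian ∂e/∂y, and it also expands
powers of y_l in the h_r; cancelling it computes ∂p_{n+k}/∂e_i (`pderiv_p`). For the Goodman–Wenzl
ideal, Jacobi–Trudi determinants of hooks produce the h_r; conversely λ_1 - λ_n = k+1 puts λ+ρ on
the affine wall, so s_λ vanishes at all fusion points. -/

noncomputable section

namespace SuFusion

/-! ### Generating series of elementary and complete symmetric polynomials. -/

open PowerSeries in
/-- The generating series of the complete symmetric polynomials evaluated at `y`. -/
def hSeries {R ι : Type*} [CommRing R] (s : Finset ι) (y : ι → R) : R⟦X⟧ :=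
  ∏ i ∈ s, PowerSeries.mk (fun a => y i ^ a)

open PowerSeries in
/-- The generating series of the signed elementary symmetric polynomials evaluated at `y`. -/
def eSeries {R ι : Type*} [CommRing R] (s : Finset ι) (y : ι → R) : R⟦X⟧ :=
  ∏ i ∈ s, (1 - C (y i) * X)

/-- The complete symmetric polynomial of integral degree `r` evaluated at `y`. -/
def hVal {R ι : Type*} [CommRing R] [Fintype ι] (y : ι → R) (r : ℤ) : R :=
  if r < 0 then 0 else PowerSeries.coeff r.toNat (hSeries Finset.univ y)

section
variable {R ι : Type*} [CommRing R]

open PowerSeries in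
theorem one_sub_mul_mk_pow (a : R) : (1 - C a * X) * PowerSeries.mk (fun r => a ^ r) = 1 := by
  ext r
  rw [sub_mul, one_mul, map_sub, mul_assoc, coeff_C_mul]
  cases r with
  | zero => simp
  | succ r => simp [coeff_succ_X_mul, coeff_one, pow_succ']

theorem eSeries_mul_hSeries (s : Finset ι) (y : ι → R) : eSeries s y * hSeries s y = 1 := by
  rw [eSeries, hSeries, ← Finset.prod_mul_distrib]
  exact Finset.prod_eq_one fun i _ => one_sub_mul_mk_pow _

open PowerSeries in
theorem coeff_eSeries (s : Finset ι) (y : ι → R) (r : ℕ) :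
    coeff r (eSeries s y) = (-1) ^ r * ∑ t ∈ s.powersetCard r, ∏ i ∈ t, y i := by
  classical
  have h1 : eSeries s y = ∑ t ∈ s.powerset, C ((-1) ^ t.card * ∏ i ∈ t, y i) * X ^ t.card := by
    have : ∀ i, (1 - C (y i) * X : R⟦X⟧) = -(C (y i) * X) + 1 := fun i => by ring
    simp only [eSeries, this]
    rw [Finset.prod_add]
    refine Finset.sum_congr rfl fun t _ => ?_
    simp [Finset.prod_neg, Finset.prod_mul_distrib]
    ring
  rw [h1, map_sum, Finset.mul_sum, Finset.powersetCard_eq_filter, Finset.sum_filter]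
  refine Finset.sum_congr rfl fun t _ => ?_
  rw [coeff_C_mul, coeff_X_pow]
  by_cases h : t.card = r
  · simp [h]
  · simp [h, Ne.symm h]

open PowerSeries in
theorem coeff_eSeries_eq_zero (s : Finset ι) (y : ι → R) {r : ℕ} (h : s.card < r) :
    coeff r (eSeries s y) = 0 := by
  rw [coeff_eSeries, Finset.powersetCard_eq_empty.2 h]; simp

theorem constantCoeff_eSeries (s : Finset ι) (y : ι → R) :
    PowerSeries.coeff 0 (eSeries s y) = 1 := by simp [coeff_eSeries]

theorem aeval_esymm {A : Type*} [CommRing A] [Algebra A R] [Fintype ι] (y : ι → R) (r : ℕ) :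
    MvPolynomial.aeval y (MvPolynomial.esymm ι A r) =
      (-1) ^ r * PowerSeries.coeff r (eSeries Finset.univ y) := by
  rw [coeff_eSeries, ← mul_assoc, ← pow_add, Even.neg_one_pow ⟨r, rfl⟩, one_mul,
    MvPolynomial.esymm, map_sum]
  simp

-- A coefficient of the product of geometric series is a sum over exponent vectors of fixed total,
-- and these correspond to multisets of that size.
open PowerSeries in
theorem aeval_hsymm {A : Type*} [CommRing A] [Algebra A R] [Fintype ι] [DecidableEq ι]
    (y : ι → R) (r : ℕ) :
    MvPolynomial.aeval y (MvPolynomial.hsymm ι A r) = hVal y r := by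
  rw [hVal, if_neg (by simp), hSeries, Int.toNat_natCast, coeff_prod, MvPolynomial.hsymm, map_sum]
  refine Finset.sum_bij' (fun s _ => Multiset.toFinsupp s.1)
    (fun f hf => ⟨Finsupp.toMultiset f, ?_⟩) ?_ ?_ ?_ ?_ ?_
  · rw [Finset.mem_finsuppAntidiag] at hf
    rw [Finsupp.card_toMultiset, Finsupp.sum_fintype _ _ (by simp)]
    exact hf.1
  · intro s _
    rw [Finset.mem_finsuppAntidiag]
    refine ⟨?_, Finset.subset_univ _⟩
    exact (Multiset.sum_count_eq_card (by simp)).trans s.2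
  · intro f hf; exact Finset.mem_univ _
  · intro s _; apply Subtype.ext; simp
  · intro f hf; simp
  · intro s _
    rw [map_multiset_prod, Multiset.map_map, Finset.prod_multiset_map_count]
    simp only [coeff_mk, Multiset.toFinsupp_apply, Function.comp, MvPolynomial.aeval_X]
    refine Finset.prod_subset (Finset.subset_univ _) fun i _ hi => ?_
    rw [Multiset.mem_toFinset] at hi
    rw [Multiset.count_eq_zero.2 hi, pow_zero]

theorem hVal_neg [Fintype ι] (y : ι → R) {r : ℤ} (h : r < 0) : hVal y r = 0 := if_pos h

theorem hVal_natCast [Fintype ι] (y : ι → R) (r : ℕ) :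
    hVal y r = PowerSeries.coeff r (hSeries Finset.univ y) := by
  simp [hVal]

theorem hVal_zero [Fintype ι] (y : ι → R) : hVal y 0 = 1 := by
  have := hVal_natCast y 0
  simpa [hSeries, map_prod] using this

open PowerSeries in
/-- Removing the last variable. -/
theorem hVal_castSucc {m : ℕ} (y : Fin (m + 1) → R) (r : ℤ) :
    hVal y r = hVal (fun i => y (Fin.castSucc i)) r + y (Fin.last m) * hVal y (r - 1) := by
  rcases lt_trichotomy r 0 with h | h | h
  · rw [hVal_neg _ h, hVal_neg _ h, hVal_neg _ (by omega)]; simp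
  · subst h; rw [hVal_zero, hVal_zero, hVal_neg _ (by omega)]; simp
  · obtain ⟨r, rfl⟩ : ∃ s : ℕ, r = s + 1 := ⟨(r - 1).toNat, by omega⟩
    rw [add_sub_cancel_right, hVal_natCast]
    have h1 : hSeries Finset.univ y * (1 - C (y (Fin.last m)) * X)
        = hSeries Finset.univ (fun i => y (Fin.castSucc i)) := by
      rw [hSeries, Fin.prod_univ_castSucc, mul_assoc, mul_comm (PowerSeries.mk _),
        one_sub_mul_mk_pow, mul_one, hSeries]
    have h2 := congrArg (coeff (r + 1)) h1
    rw [mul_sub, mul_one, map_sub, mul_comm, mul_assoc, coeff_C_mul, coeff_succ_X_mul] at h2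
    have h3 := hVal_natCast y (r + 1)
    have h4 := hVal_natCast (fun i => y (Fin.castSucc i)) (r + 1)
    push_cast at h3 h4
    rw [h3, h4, ← h2]; ring

/-- Removing the last variable, iterated. -/
theorem hVal_castSucc_iterate {m : ℕ} (y : Fin (m + 1) → R) (r : ℤ) (d : ℕ) :
    hVal y (r + d) - y (Fin.last m) ^ d * hVal y r =
      ∑ b ∈ Finset.range d, y (Fin.last m) ^ (d - 1 - b) *
        hVal (fun i => y (Fin.castSucc i)) (r + 1 + b) := by
  induction d with
  | zero => simp
  | succ d ih =>
    rw [Finset.sum_range_succ, hVal_castSucc y]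
    have : r + ((d + 1 : ℕ) : ℤ) - 1 = r + d := by push_cast; ring
    rw [this, ← sub_eq_zero]
    have h2 : ∑ b ∈ Finset.range d, y (Fin.last m) ^ (d + 1 - 1 - b) *
        hVal (fun i => y (Fin.castSucc i)) (r + 1 + b) = y (Fin.last m) *
        ∑ b ∈ Finset.range d, y (Fin.last m) ^ (d - 1 - b) *
        hVal (fun i => y (Fin.castSucc i)) (r + 1 + b) := by
      rw [Finset.mul_sum]
      refine Finset.sum_congr rfl fun b hb => ?_
      have : d + 1 - 1 - b = (d - 1 - b) + 1 := by have := Finset.mem_range.1 hb; omega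
      rw [this, pow_succ]; ring
    rw [h2, ← ih]
    have h3 : r + ((d + 1 : ℕ) : ℤ) = r + 1 + d := by push_cast; ring
    rw [h3]
    simp
    ring

theorem hVal_map {S : Type*} [CommRing S] [Fintype ι] (f : R →+* S) (y : ι → R) (r : ℤ) :
    f (hVal y r) = hVal (fun i => f (y i)) r := by
  unfold hVal
  split_ifs
  · simp
  · have : hSeries Finset.univ (fun i => f (y i)) = PowerSeries.map f (hSeries Finset.univ y) := by
      simp only [hSeries, map_prod]
      refine Finset.prod_congr rfl fun i _ => ?_
      ext; simp
    rw [this, PowerSeries.coeff_map]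

end

/-! ### Tableaux and the Jacobi–Trudi formula. -/

/-- Semistandard tableaux with `n` rows and entries in an alphabet of `m` letters. -/
def IsTableau {n m : ℕ} (lam : Fin n → ℕ) (T : (Σ i : Fin n, Fin (lam i)) → Fin m) : Prop :=
  (∀ (i : Fin n) (a b : Fin (lam i)), a ≤ b → T ⟨i, a⟩ ≤ T ⟨i, b⟩) ∧
  (∀ (i j : Fin n) (a : Fin (lam i)) (b : Fin (lam j)),
    i < j → (a : ℕ) = (b : ℕ) → T ⟨i, a⟩ < T ⟨j, b⟩)

open Classical in
/-- The weighted sum of the tableaux of shape `lam`. -/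
def tableauSum {R : Type*} [CommRing R] {n m : ℕ} (lam : Fin n → ℕ) (y : Fin m → R) : R :=
  ∑ T : (Σ i : Fin n, Fin (lam i)) → Fin m with IsTableau lam T, ∏ c, y (T c)

/-- The part following the given one, `0` after the last one. -/
def nextPart {n : ℕ} (lam : Fin n → ℕ) (i : Fin n) : ℕ :=
  if h : (i : ℕ) + 1 < n then lam ⟨i + 1, h⟩ else 0

/-- The partitions `μ` such that `lam / μ` is a horizontal strip. -/
def interlacing {n : ℕ} (lam : Fin n → ℕ) : Finset (Fin n → ℕ) :=
  Fintype.piFinset fun i => Finset.Icc (nextPart lam i) (lam i)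

theorem mem_interlacing {n : ℕ} {lam mu : Fin n → ℕ} :
    mu ∈ interlacing lam ↔ ∀ i, nextPart lam i ≤ mu i ∧ mu i ≤ lam i := by
  simp [interlacing]

theorem le_nextPart {n : ℕ} {lam : Fin n → ℕ} (hl : Antitone lam) {i j : Fin n} (h : i < j) :
    lam j ≤ nextPart lam i := by
  have h1 : (i : ℕ) + 1 < n := by have := j.2; have : (i : ℕ) < j := h; omega
  rw [nextPart, dif_pos h1]
  exact hl (show (⟨i + 1, h1⟩ : Fin n) ≤ j from h)

theorem nextPart_le {n : ℕ} {lam : Fin n → ℕ} (hl : Antitone lam) (i : Fin n) :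
    nextPart lam i ≤ lam i := by
  unfold nextPart
  split_ifs with h
  · exact hl (show (i : ℕ) ≤ i + 1 by omega)
  · exact Nat.zero_le _

theorem antitone_of_mem_interlacing {n : ℕ} {lam mu : Fin n → ℕ} (hl : Antitone lam)
    (h : mu ∈ interlacing lam) : Antitone mu := by
  rw [mem_interlacing] at h
  intro i j hij
  rcases hij.eq_or_lt with rfl | hij
  · exact le_rfl
  · exact ((h j).2.trans (le_nextPart hl hij)).trans (h i).1

/-- A downward closed subset of `Fin N` is an initial segment, so its cardinality is its end point.
-/
theorem lt_card_filter_iff {N : ℕ} (p : Fin N → Prop) [DecidablePred p]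
    (hp : ∀ a b, a ≤ b → p b → p a) (a : Fin N) :
    (a : ℕ) < (Finset.univ.filter p).card ↔ p a := by
  constructor
  · intro h
    by_contra hpa
    have : Finset.univ.filter p ⊆ Finset.Iio a := fun b hb => by
      rw [Finset.mem_Iio]
      by_contra hba
      exact hpa (hp _ _ (not_lt.1 hba) (Finset.mem_filter.1 hb).2)
    have := Finset.card_le_card this
    rw [Fin.card_Iio] at this
    omega
  · intro h
    have : Finset.Iic a ⊆ Finset.univ.filter p := fun b hb => by
      simp only [Finset.mem_filter, Finset.mem_univ, true_and]
      exact hp _ _ (Finset.mem_Iic.1 hb) h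
    have := Finset.card_le_card this
    rw [Fin.card_Iic] at this
    omega

theorem prod_dite_lt {R : Type*} [CommRing R] {M L : ℕ} (h : M ≤ L) (z : Fin M → R) (x : R) :
    ∏ a : Fin L, (if h : (a : ℕ) < M then z ⟨a, h⟩ else x) = x ^ (L - M) * ∏ a, z a := by
  obtain ⟨d, rfl⟩ := Nat.exists_eq_add_of_le h
  rw [Fin.prod_univ_add]
  simp [mul_comm]

/-- Extension of a filling of a smaller diagram by the last letter. -/
def extendFilling {n m : ℕ} (lam mu : Fin n → ℕ) (T : (Σ i : Fin n, Fin (mu i)) → Fin m) :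
    (Σ i : Fin n, Fin (lam i)) → Fin (m + 1) := fun c =>
  if h : (c.2 : ℕ) < mu c.1 then Fin.castSucc (T ⟨c.1, ⟨c.2, h⟩⟩) else Fin.last m

/-- The number of boxes in a row that do not hold the last letter. -/
def innerShape {n m : ℕ} (lam : Fin n → ℕ) (T : (Σ i : Fin n, Fin (lam i)) → Fin (m + 1))
    (i : Fin n) : ℕ :=
  (Finset.univ.filter fun a : Fin (lam i) => T ⟨i, a⟩ ≠ Fin.last m).card

theorem lt_innerShape_iff {n m : ℕ} {lam : Fin n → ℕ}
    {T : (Σ i : Fin n, Fin (lam i)) → Fin (m + 1)} (hT : IsTableau lam T) (i : Fin n)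
    (a : Fin (lam i)) : (a : ℕ) < innerShape lam T i ↔ T ⟨i, a⟩ ≠ Fin.last m := by
  refine lt_card_filter_iff (fun a : Fin (lam i) => T ⟨i, a⟩ ≠ Fin.last m) ?_ a
  intro a b hab hb ha
  exact hb (Fin.last_le_iff.1 (ha ▸ hT.1 i a b hab))

/-- If row `i` kept fewer boxes than row `i + 1` has in all, some box holding the last letter would
have a box below it, which would need a larger letter. -/
theorem innerShape_mem {n m : ℕ} {lam : Fin n → ℕ} (hl : Antitone lam)
    {T : (Σ i : Fin n, Fin (lam i)) → Fin (m + 1)} (hT : IsTableau lam T) :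
    innerShape lam T ∈ interlacing lam := by
  rw [mem_interlacing]
  intro i
  constructor
  · by_contra hlt
    rw [not_le] at hlt
    have h1 : (i : ℕ) + 1 < n := by
      by_contra h
      rw [nextPart, dif_neg h] at hlt
      omega
    have h2 := nextPart_le hl i
    have h3 := (lt_innerShape_iff hT i ⟨innerShape lam T i, hlt.trans_le h2⟩).not.1 (lt_irrefl _)
    rw [not_not] at h3
    rw [nextPart, dif_pos h1] at hlt
    have h4 := hT.2 i ⟨i + 1, h1⟩
      ⟨innerShape lam T i, hlt.trans_le (hl (show (i : ℕ) ≤ i + 1 by omega))⟩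
      ⟨innerShape lam T i, hlt⟩ (show (i : ℕ) < i + 1 by omega) rfl
    rw [h3] at h4
    exact absurd (Fin.le_last _) (not_le.2 h4)
  · exact (Finset.card_filter_le _ _).trans (by simp)

/-- The boxes with the last letter form a horizontal strip; deleting them is a bijection onto the
tableaux of the inner shape with one letter fewer. -/
theorem tableauSum_succ {R : Type*} [CommRing R] {n m : ℕ} {lam : Fin n → ℕ} (hl : Antitone lam)
    (y : Fin (m + 1) → R) :
    tableauSum lam y = ∑ mu ∈ interlacing lam, (∏ i, y (Fin.last m) ^ (lam i - mu i)) *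
      tableauSum mu (fun i => y (Fin.castSucc i)) := by
  classical
  rw [tableauSum, ← Finset.sum_fiberwise_of_maps_to (t := interlacing lam)
    (g := innerShape lam) (fun T hT => innerShape_mem hl (Finset.mem_filter.1 hT).2)]
  refine Finset.sum_congr rfl fun mu hmu => ?_
  have hmu' := mem_interlacing.1 hmu
  rw [tableauSum, Finset.mul_sum]
  symm
  refine Finset.sum_bij (fun T _ => extendFilling lam mu T) ?_ ?_ ?_ ?_
  · intro T hT
    replace hT := (Finset.mem_filter.1 hT).2
    have h0 : IsTableau lam (extendFilling lam mu T) := by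
      constructor
      · intro i a b hab
        simp only [extendFilling]
        split_ifs with h1 h2 h2
        · exact Fin.castSucc_le_castSucc_iff.2 (hT.1 _ _ _ hab)
        · exact Fin.le_last _
        · exact absurd (lt_of_le_of_lt (show (a : ℕ) ≤ b from hab) h2) h1
        · exact le_rfl
      · intro i j a b hij hab
        -- A box with another one below it lies in the inner shape, because `mu i` is at least the
        -- next part. So the upper entry is never the added letter.
        have h3 : (a : ℕ) < mu i :=
          hab ▸ b.2.trans_le ((le_nextPart hl hij).trans (hmu' i).1)
        simp only [extendFilling]
        rw [dif_pos h3]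
        split_ifs with h2
        · exact Fin.castSucc_lt_castSucc_iff.2 (hT.2 _ _ _ _ hij hab)
        · exact Fin.castSucc_lt_last _
    rw [Finset.mem_filter, Finset.mem_filter]
    refine ⟨⟨Finset.mem_univ _, h0⟩, ?_⟩
    funext i
    have h1 : ∀ a : Fin (lam i), (a : ℕ) < innerShape lam (extendFilling lam mu T) i ↔
        (a : ℕ) < mu i := fun a => by
      rw [lt_innerShape_iff h0]
      simp only [extendFilling]
      split_ifs with h
      · simp [h, (Fin.castSucc_lt_last _).ne]
      · simp [h]
    have h2 := (mem_interlacing.1 (innerShape_mem hl h0) i).2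
    have h3 := (hmu' i).2
    rcases lt_trichotomy (innerShape lam (extendFilling lam mu T) i) (mu i) with h | h | h
    · exact absurd ((h1 ⟨_, h.trans_le h3⟩).2 h) (lt_irrefl _)
    · exact h
    · exact absurd ((h1 ⟨_, h.trans_le h2⟩).1 h) (lt_irrefl _)
  · intro T _ T' _ h
    funext ⟨i, a⟩
    have := congrFun h ⟨i, ⟨a, a.2.trans_le (hmu' i).2⟩⟩
    simpa [extendFilling] using this
  · intro T hT
    rw [Finset.mem_filter, Finset.mem_filter] at hT
    obtain ⟨⟨-, hT⟩, rfl⟩ := hT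
    have h1 : ∀ c : (Σ i : Fin n, Fin (innerShape lam T i)),
        T ⟨c.1, ⟨c.2, c.2.2.trans_le (hmu' c.1).2⟩⟩ ≠ Fin.last m := fun c =>
      (lt_innerShape_iff hT c.1 ⟨c.2, c.2.2.trans_le (hmu' c.1).2⟩).1 c.2.2
    refine ⟨fun c => Fin.castPred _ (h1 c), ?_, ?_⟩
    · rw [Finset.mem_filter]
      refine ⟨Finset.mem_univ _, ?_, ?_⟩
      · intro i a b hab
        exact Fin.castPred_le_castPred_iff.2 (hT.1 _ _ _ hab)
      · intro i j a b hij hab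
        exact Fin.castPred_lt_castPred_iff.2 (hT.2 _ _ _ _ hij hab)
    · funext ⟨i, a⟩
      simp only [extendFilling]
      split_ifs with h
      · simp
      · rw [lt_innerShape_iff hT, not_not] at h
        exact h.symm
  · intro T _
    rw [Fintype.prod_sigma, Fintype.prod_sigma, ← Finset.prod_mul_distrib]
    refine Finset.prod_congr rfl fun i _ => ?_
    rw [← prod_dite_lt (hmu' i).2]
    refine Finset.prod_congr rfl fun a _ => ?_
    simp only [extendFilling]
    split_ifs <;> rfl

/-- The Jacobi–Trudi determinant. -/
def jacobiTrudi {R : Type*} [CommRing R] {n m : ℕ} (lam : Fin n → ℕ) (y : Fin m → R) : R :=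
  Matrix.det (Matrix.of fun i j : Fin n => hVal y ((lam i : ℤ) - (i : ℕ) + (j : ℕ)))

/-- The left side is a row operation on the Jacobi–Trudi matrix: the second term is a multiple of
the entry in row `i + 1`. The right side is a sum of rows in one variable fewer. -/
theorem hVal_sub_nextPart {R : Type*} [CommRing R] {n m : ℕ} {lam : Fin n → ℕ} (hl : Antitone lam)
    (y : Fin (m + 1) → R) (i j : Fin n) :
    hVal y ((lam i : ℤ) - (i : ℕ) + (j : ℕ)) - y (Fin.last m) ^ (lam i - nextPart lam i + 1) *
        hVal y ((nextPart lam i : ℤ) - (i : ℕ) - 1 + (j : ℕ)) =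
      ∑ b ∈ Finset.Icc (nextPart lam i) (lam i), y (Fin.last m) ^ (lam i - b) *
        hVal (fun i => y (Fin.castSucc i)) ((b : ℤ) - (i : ℕ) + (j : ℕ)) := by
  have h := nextPart_le hl i
  have h1 := hVal_castSucc_iterate y ((nextPart lam i : ℤ) - (i : ℕ) - 1 + (j : ℕ))
    (lam i - nextPart lam i + 1)
  have h2 : (nextPart lam i : ℤ) - (i : ℕ) - 1 + (j : ℕ) + ((lam i - nextPart lam i + 1 : ℕ) : ℤ)
      = (lam i : ℤ) - (i : ℕ) + (j : ℕ) := by push_cast [h]; ring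
  rw [h2] at h1
  rw [h1, ← Finset.Ico_add_one_right_eq_Icc, Finset.sum_Ico_eq_sum_range,
    show lam i + 1 - nextPart lam i = lam i - nextPart lam i + 1 by omega]
  refine Finset.sum_congr rfl fun b hb => ?_
  congr 2
  · omega
  · push_cast; ring

/-- The same recursion as for tableaux. The unitriangular factor `1 - K` subtracts from each row a
multiple of the next one; the new rows are sums over the interval between consecutive parts, and
multilinearity expands the determinant over the interlacing shapes. -/
theorem jacobiTrudi_succ {R : Type*} [CommRing R] {n m : ℕ} {lam : Fin n → ℕ} (hl : Antitone lam)
    (y : Fin (m + 1) → R) :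
    jacobiTrudi lam y = ∑ mu ∈ interlacing lam, (∏ i, y (Fin.last m) ^ (lam i - mu i)) *
      jacobiTrudi mu (fun i => y (Fin.castSucc i)) := by
  classical
  let A : Matrix (Fin n) (Fin n) R := Matrix.of fun i j => hVal y ((lam i : ℤ) - (i : ℕ) + (j : ℕ))
  let K : Matrix (Fin n) (Fin n) R := Matrix.of fun i l =>
    if (l : ℕ) = i + 1 then y (Fin.last m) ^ (lam i - nextPart lam i + 1) else 0
  let B : Matrix (Fin n) (Fin n) R := Matrix.of fun i j =>
    ∑ b ∈ Finset.Icc (nextPart lam i) (lam i), y (Fin.last m) ^ (lam i - b) *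
        hVal (fun i => y (Fin.castSucc i)) ((b : ℤ) - (i : ℕ) + (j : ℕ))
  have h1 : (1 - K) * A = B := by
    ext i j
    rw [sub_mul, one_mul, Matrix.sub_apply, Matrix.mul_apply]
    simp only [A, B, K, Matrix.of_apply]
    rw [← hVal_sub_nextPart hl]
    congr 1
    by_cases h : (i : ℕ) + 1 < n
    · rw [Finset.sum_eq_single ⟨i + 1, h⟩]
      · rw [if_pos rfl]
        congr 2
        simp only [nextPart, dif_pos h]
        push_cast; ring
      · intro l _ hl
        rw [if_neg (fun h' => hl (Fin.ext h')), zero_mul]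
      · intro h; exact absurd (Finset.mem_univ _) h
    -- The last row has no successor, and none is needed: the subtracted term has degree `j - n <
    -- 0`.
    · rw [Finset.sum_eq_zero]
      · rw [hVal_neg, mul_zero]
        rw [nextPart, dif_neg h]
        have := j.2
        push_cast; omega
      · intro l _
        rw [if_neg (by have := l.2; omega), zero_mul]
  have h2 : (1 - K).det = 1 := by
    rw [Matrix.det_of_isUpperTriangular]
    · refine Finset.prod_eq_one fun i _ => ?_
      simp [K]
    · intro i j hij
      have hij' : (j : ℕ) < i := hij
      rw [Matrix.sub_apply, Matrix.one_apply_ne (show i ≠ j from Ne.symm (ne_of_lt hij))]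
      simp only [K, Matrix.of_apply]
      rw [if_neg (by omega), sub_zero]
  have h3 : jacobiTrudi lam y = B.det := by
    rw [← h1, Matrix.det_mul, h2, one_mul]; rfl
  rw [h3]
  have h4 := (Matrix.detRowAlternating (n := Fin n) (R := R)).toMultilinearMap.map_sum_finset
    (fun i (b : ℕ) (j : Fin n) => y (Fin.last m) ^ (lam i - b) *
        hVal (fun i => y (Fin.castSucc i)) ((b : ℤ) - (i : ℕ) + (j : ℕ)))
    (fun i => Finset.Icc (nextPart lam i) (lam i))
  have h5 : B = fun i => ∑ b ∈ Finset.Icc (nextPart lam i) (lam i), fun j : Fin n =>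
      y (Fin.last m) ^ (lam i - b) *
        hVal (fun i => y (Fin.castSucc i)) ((b : ℤ) - (i : ℕ) + (j : ℕ)) := by
    ext i j
    simp [B]
  rw [h5]
  refine h4.trans (Finset.sum_congr rfl fun mu _ => ?_)
  exact Matrix.det_mul_column _ _

/-- Induction on the number of letters, which is why it is kept separate from the number of rows.
With no letters both sides are 1 for the empty shape and 0 otherwise. -/
theorem jacobiTrudi_eq_tableauSum {R : Type*} [CommRing R] {n m : ℕ} (lam : Fin n → ℕ)
    (hl : Antitone lam) (y : Fin m → R) : jacobiTrudi lam y = tableauSum lam y := by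
  classical
  induction m generalizing lam with
  | succ m ih =>
    rw [jacobiTrudi_succ hl, tableauSum_succ hl]
    exact Finset.sum_congr rfl fun mu hmu => by rw [ih mu (antitone_of_mem_interlacing hl hmu)]
  | zero =>
    have h0 : ∀ r : ℤ, hVal y r = if r = 0 then 1 else 0 := by
      intro r
      split_ifs with h
      · rw [h, hVal_zero]
      · rcases lt_or_gt_of_ne h with h | h
        · exact hVal_neg _ h
        · obtain ⟨r, rfl⟩ := Int.eq_ofNat_of_zero_le h.le
          rw [hVal_natCast, hSeries]
          simp [PowerSeries.coeff_one]
          omega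
    by_cases h : ∀ i, lam i = 0
    · have : lam = fun _ => 0 := funext h
      subst this
      have h1 : jacobiTrudi (fun _ : Fin n => 0) y = 1 := by
        rw [jacobiTrudi, ← Matrix.det_one (n := Fin n)]
        congr 1
        ext i j
        rw [Matrix.of_apply, h0, Matrix.one_apply]
        refine if_congr ?_ rfl rfl
        rw [Fin.ext_iff]
        push_cast; omega
      rw [h1, tableauSum, Finset.filter_true_of_mem]
      · have : IsEmpty (Σ i : Fin n, Fin ((fun _ : Fin n => 0) i)) :=
          ⟨fun c => Fin.elim0 c.2⟩
        simp
      · intro T _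
        exact ⟨fun i a => Fin.elim0 a, fun i j a => Fin.elim0 a⟩
    · push Not at h
      obtain ⟨i, hi⟩ := h
      have hn : 0 < n := i.pos
      have hlam : 0 < lam ⟨0, hn⟩ :=
        (Nat.pos_of_ne_zero hi).trans_le (hl (Fin.mk_le_of_le_val (Nat.zero_le _)))
      rw [jacobiTrudi, Matrix.det_eq_zero_of_row_eq_zero ⟨0, hn⟩]
      · rw [tableauSum]
        refine (Finset.sum_eq_zero fun T _ => ?_).symm
        exact Fin.elim0 (T ⟨i, ⟨0, Nat.pos_of_ne_zero hi⟩⟩)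
      · intro j
        rw [Matrix.of_apply, h0, if_neg]
        push_cast; omega

theorem schur_eq_tableauSum {n : ℕ} (lam : Fin n → ℕ) :
    schur lam = tableauSum lam (MvPolynomial.X : Fin n → MvPolynomial (Fin n) ℂ) := rfl

/-! ### Alternants and the bialternant formula. -/

section
variable {R : Type*} [CommRing R] {n : ℕ}

/-- The coefficients of the products `∏_{m ≠ l} (1 - y_m X)`, in reversed order. -/
def cofactorMatrix (y : Fin n → R) : Matrix (Fin n) (Fin n) R := Matrix.of fun j l =>
  PowerSeries.coeff (n - 1 - j) (eSeries (Finset.univ.erase l) y)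

theorem eSeries_erase_mul_hSeries {ι : Type*} [Fintype ι] [DecidableEq ι] (y : ι → R) (l : ι) :
    eSeries (Finset.univ.erase l) y * hSeries Finset.univ y =
      PowerSeries.mk (fun a => y l ^ a) := by
  rw [hSeries, ← Finset.mul_prod_erase Finset.univ _ (Finset.mem_univ l), mul_left_comm,
    ← hSeries, eSeries_mul_hSeries, mul_one]

/-- Expansion of the powers of a variable in complete symmetric polynomials. -/
theorem sum_hVal_mul_cofactorMatrix (y : Fin n → R) (l : Fin n) (a : ℕ) :
    ∑ j : Fin n, hVal y ((a : ℤ) - (n - 1 : ℕ) + (j : ℕ)) * cofactorMatrix y j l = y l ^ a := by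
  have h1 := congrArg (PowerSeries.coeff a) (eSeries_erase_mul_hSeries y l)
  rw [PowerSeries.coeff_mk, PowerSeries.coeff_mul, Finset.Nat.sum_antidiagonal_eq_sum_range_succ
    (fun i j => PowerSeries.coeff i (eSeries (Finset.univ.erase l) y) *
      PowerSeries.coeff j (hSeries Finset.univ y))] at h1
  rw [← h1]
  have hn : 0 < n := l.pos
  let f : ℕ → R := fun i => PowerSeries.coeff i (eSeries (Finset.univ.erase l) y) *
    hVal y ((a : ℤ) - i)
  -- Both sums may be cut at the shorter range: beyond `a` the complete symmetric polynomial has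
  -- negative degree, and from `n` on the product of `n - 1` factors has no coefficient.
  have h2 : ∑ i ∈ Finset.range (a + 1), f i = ∑ i ∈ Finset.range n, f i := by
    rcases le_total (a + 1) n with h | h
    · refine Finset.sum_subset (Finset.range_mono h) fun i _ hi => ?_
      rw [Finset.mem_range, not_lt] at hi
      simp only [f]
      rw [hVal_neg _ (by omega), mul_zero]
    · symm
      refine Finset.sum_subset (Finset.range_mono h) fun i _ hi => ?_
      rw [Finset.mem_range, not_lt] at hi
      simp only [f]
      rw [coeff_eSeries_eq_zero, zero_mul]
      rw [Finset.card_erase_of_mem (Finset.mem_univ _), Finset.card_univ, Fintype.card_fin]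
      omega
  calc _ = ∑ i ∈ Finset.range n, f i := by
        rw [← Finset.sum_range_reflect, Finset.sum_range]
        refine Finset.sum_congr rfl fun j _ => ?_
        simp only [f, cofactorMatrix, Matrix.of_apply]
        rw [mul_comm]
        congr 2
        have := j.2
        omega
    _ = _ := by
        rw [← h2]
        refine Finset.sum_congr rfl fun i hi => ?_
        have := Finset.mem_range.1 hi
        simp only [f]
        rw [← Nat.cast_sub (by omega), hVal_natCast]

/-- The alternant with the given exponents. -/
def alternant (y : Fin n → R) (a : Fin n → ℕ) : R := Matrix.det (Matrix.of fun i l => y l ^ a i)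

theorem det_hVal_mul_det_cofactorMatrix (y : Fin n → R) (a : Fin n → ℕ) :
    Matrix.det (Matrix.of fun i j : Fin n => hVal y ((a i : ℤ) - (n - 1 : ℕ) + (j : ℕ))) *
      (cofactorMatrix y).det = alternant y a := by
  rw [← Matrix.det_mul, alternant]
  congr 1
  ext i l
  rw [Matrix.mul_apply]
  simp only [Matrix.of_apply]
  exact sum_hVal_mul_cofactorMatrix y l (a i)

/-- The exponents `λ + ρ`. -/
def addRho (lam : Fin n → ℕ) (i : Fin n) : ℕ := lam i + (n - 1 - i)

theorem jacobiTrudi_mul_det_cofactorMatrix (y : Fin n → R) (lam : Fin n → ℕ) :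
    jacobiTrudi lam y * (cofactorMatrix y).det = alternant y (addRho lam) := by
  rw [← det_hVal_mul_det_cofactorMatrix, jacobiTrudi]
  congr 3
  ext i j
  congr 1
  have := i.2
  simp only [addRho]
  push_cast
  omega

theorem jacobiTrudi_zero (y : Fin n → R) : jacobiTrudi (fun _ : Fin n => 0) y = 1 := by
  rw [jacobiTrudi, Matrix.det_of_isUpperTriangular]
  · refine Finset.prod_eq_one fun i _ => ?_
    rw [Matrix.of_apply, ← hVal_zero y]
    congr 1
    push_cast; ring
  · intro i j hij
    have hij' : (j : ℕ) < i := hij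
    rw [Matrix.of_apply, hVal_neg]
    push_cast; omega

/-- This is the case of the empty partition, where the Jacobi–Trudi matrix is unitriangular; the
determinant need not be computed directly. -/
theorem det_cofactorMatrix (y : Fin n → R) :
    (cofactorMatrix y).det = alternant y (addRho fun _ => 0) := by
  rw [← jacobiTrudi_mul_det_cofactorMatrix, jacobiTrudi_zero, one_mul]

/-- The bialternant formula. -/
theorem jacobiTrudi_mul_alternant (y : Fin n → R) (lam : Fin n → ℕ) :
    jacobiTrudi lam y * alternant y (addRho fun _ => 0) = alternant y (addRho lam) := by
  rw [← det_cofactorMatrix, jacobiTrudi_mul_det_cofactorMatrix]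

theorem alternant_rho_ne_zero [IsDomain R] {y : Fin n → R} (hy : Function.Injective y) :
    alternant y (addRho fun _ => 0) ≠ 0 := by
  have h1 := Matrix.det_permute (Fin.revPerm (n := n))
    (Matrix.of fun i l : Fin n => y l ^ (i : ℕ))
  have h2 : alternant y (addRho fun _ => 0) =
      ((Matrix.of fun i l : Fin n => y l ^ (i : ℕ)).submatrix (Fin.revPerm (n := n)) id).det := by
    rw [alternant]
    congr 1
    ext i l
    simp only [Matrix.of_apply, Matrix.submatrix_apply, addRho, Fin.revPerm_apply, Fin.val_rev, id]
    congr 1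
    omega
  have h3 : (Matrix.of fun i l : Fin n => y l ^ (i : ℕ)) = (Matrix.vandermonde y).transpose := by
    ext i l; simp [Matrix.vandermonde_apply]
  rw [h2, h1, h3, Matrix.det_transpose]
  refine mul_ne_zero ?_ (Matrix.det_vandermonde_ne_zero_iff.2 hy)
  rcases Int.units_eq_one_or (Equiv.Perm.sign (Fin.revPerm (n := n))) with h | h <;> simp [h]

end

/-! ### Polynomials in `e_1, …, e_n` as functions of `y` -/

/-- The symmetric polynomial in `y` given by an element of `ℂ[e_1, …, e_n]`. -/
def symHom (n : ℕ) : ERing n →ₐ[ℂ] MvPolynomial (Fin n) ℂ :=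
  (MvPolynomial.symmetricSubalgebra (Fin n) ℂ).val.comp (toSym n).toAlgHom

theorem symHom_apply (n : ℕ) (q : ERing n) : symHom n q = (toSym n q).1 := rfl

theorem symHom_injective (n : ℕ) : Function.Injective (symHom n) :=
  Subtype.val_injective.comp (toSym n).injective

theorem symHom_isSymmetric {n : ℕ} (q : ERing n) : (symHom n q).IsSymmetric := (toSym n q).2

theorem exists_symHom_eq {n : ℕ} {f : MvPolynomial (Fin n) ℂ} (hf : f.IsSymmetric) :
    ∃ q, symHom n q = f := ⟨(toSym n).symm ⟨f, hf⟩, by rw [symHom_apply, AlgEquiv.apply_symm_apply]⟩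

theorem symHom_e (n r : ℕ) : symHom n (e n r) = MvPolynomial.esymm (Fin n) ℂ r := by
  rw [symHom_apply, e, AlgEquiv.apply_symm_apply]

theorem symHom_h (n r : ℕ) : symHom n (h n r) = MvPolynomial.hsymm (Fin n) ℂ r := by
  rw [symHom_apply, h, AlgEquiv.apply_symm_apply]

theorem symHom_p (n r : ℕ) : symHom n (p n r) = MvPolynomial.psum (Fin n) ℂ r := by
  rw [symHom_apply, p, AlgEquiv.apply_symm_apply]

theorem symHom_X {n : ℕ} (i : Fin n) :
    symHom n (MvPolynomial.X i) = MvPolynomial.esymm (Fin n) ℂ (i + 1) := by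
  change (MvPolynomial.esymmAlgHom (Fin n) ℂ n (MvPolynomial.X i)).1 = _
  rw [MvPolynomial.esymmAlgHom_apply, MvPolynomial.aeval_X]

theorem hVal_X (n r : ℕ) :
    hVal (MvPolynomial.X : Fin n → MvPolynomial (Fin n) ℂ) r = MvPolynomial.hsymm (Fin n) ℂ r := by
  rw [← aeval_hsymm (A := ℂ)]
  simp

/-- The complete symmetric polynomials of integral degree in `ℂ[e_1, …, e_n]`. -/
def hInt (n : ℕ) (r : ℤ) : ERing n := if r < 0 then 0 else h n r.toNat

theorem symHom_hInt (n : ℕ) (r : ℤ) :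
    symHom n (hInt n r) = hVal (MvPolynomial.X : Fin n → MvPolynomial (Fin n) ℂ) r := by
  rw [hInt]
  split_ifs with h
  · rw [map_zero, hVal_neg _ h]
  · rw [symHom_h, ← hVal_X, Int.toNat_of_nonneg (not_lt.1 h)]

theorem hInt_zero (n : ℕ) : hInt n 0 = 1 := symHom_injective n <| by
  rw [symHom_hInt, hVal_zero, map_one]

/-- The Schur polynomial in `ℂ[e_1, …, e_n]`, as a Jacobi–Trudi determinant. -/
def schurE {n : ℕ} (lam : Fin n → ℕ) : ERing n :=
  Matrix.det (Matrix.of fun i j : Fin n => hInt n ((lam i : ℤ) - (i : ℕ) + (j : ℕ)))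

theorem symHom_schurE {n : ℕ} (lam : Fin n → ℕ) :
    symHom n (schurE lam) = jacobiTrudi lam (MvPolynomial.X : Fin n → MvPolynomial (Fin n) ℂ) := by
  rw [schurE, AlgHom.map_det, jacobiTrudi]
  congr 1
  ext i j : 2
  simp [symHom_hInt]

theorem isSchur_iff {n : ℕ} {lam : Fin n → ℕ} (hl : Antitone lam) (q : ERing n) :
    IsSchur lam q ↔ q = schurE lam := by
  rw [← (symHom_injective n).eq_iff, symHom_schurE, jacobiTrudi_eq_tableauSum lam hl,
    ← schur_eq_tableauSum]
  rfl

/-- Evaluation of an element of `ℂ[e_1, …, e_n]` at a point `y`. -/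
def evalAt {n : ℕ} (y : Fin n → ℂ) : ERing n →ₐ[ℂ] ℂ := (MvPolynomial.aeval y).comp (symHom n)

theorem evalAt_apply {n : ℕ} (y : Fin n → ℂ) (q : ERing n) :
    evalAt y q = MvPolynomial.aeval y (symHom n q) := rfl

theorem evalAt_h {n : ℕ} (y : Fin n → ℂ) (r : ℕ) : evalAt y (h n r) = hVal y r := by
  rw [evalAt_apply, symHom_h, aeval_hsymm]

theorem evalAt_e {n : ℕ} (y : Fin n → ℂ) : evalAt y (e n n) = ∏ i, y i := by
  rw [evalAt_apply, symHom_e, MvPolynomial.esymm, map_sum]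
  have : Finset.powersetCard n (Finset.univ : Finset (Fin n)) = {Finset.univ} := by
    simpa using Finset.powersetCard_self (Finset.univ : Finset (Fin n))
  rw [this]
  simp

theorem evalAt_schurE {n : ℕ} (y : Fin n → ℂ) (lam : Fin n → ℕ) :
    evalAt y (schurE lam) = jacobiTrudi lam y := by
  rw [evalAt_apply, symHom_schurE, jacobiTrudi, AlgHom.map_det, jacobiTrudi]
  congr 1
  ext i j
  simp only [AlgHom.mapMatrix_apply, Matrix.map_apply, Matrix.of_apply]
  rw [← AlgHom.coe_toRingHom, hVal_map]
  simp

theorem evalAt_comp_perm {n : ℕ} (y : Fin n → ℂ) (w : Equiv.Perm (Fin n)) (q : ERing n) :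
    evalAt (fun i => y (w i)) q = evalAt y q := by
  rw [evalAt_apply, evalAt_apply]
  conv_rhs => rw [← symHom_isSymmetric q w]
  rw [MvPolynomial.aeval_rename]
  rfl

/-! ### The ideal of the fusion potential -/

theorem pderiv_coeff_eSeries {n : ℕ} (l : Fin n) (s : Finset (Fin n)) (hl : l ∉ s) (r : ℕ) :
    MvPolynomial.pderiv l (PowerSeries.coeff r
      (eSeries s (MvPolynomial.X : Fin n → MvPolynomial (Fin n) ℂ))) = 0 := by
  rw [coeff_eSeries]
  have h1 : ∀ t ∈ s.powersetCard r,
      MvPolynomial.pderiv l (∏ i ∈ t, (MvPolynomial.X i : MvPolynomial (Fin n) ℂ)) = 0 := by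
    intro t ht
    have hlt : l ∉ t := fun h => hl ((Finset.mem_powersetCard.1 ht).1 h)
    clear ht
    induction t using Finset.induction_on with
    | empty => simp
    | insert i t hi ih =>
      rw [Finset.prod_insert hi, Derivation.leibniz,
        ih (fun h => hlt (Finset.mem_insert_of_mem h)),
        MvPolynomial.pderiv_X_of_ne (fun h : i = l => hlt (h ▸ Finset.mem_insert_self _ _))]
      simp
  have h2 : ((-1 : MvPolynomial (Fin n) ℂ)) ^ r = MvPolynomial.C ((-1) ^ r) := by simp
  rw [h2, MvPolynomial.pderiv_C_mul, map_sum, Finset.sum_eq_zero h1, mul_zero]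

/-- Only the factor `1 - y_l X` of the generating series involves `y_l`. The Jacobian of `y ↦ e(y)`
is thus `cofactorMatrix` up to signs and the order of rows. -/
theorem pderiv_esymm {n : ℕ} (l : Fin n) (r : ℕ) :
    MvPolynomial.pderiv l (MvPolynomial.esymm (Fin n) ℂ (r + 1)) = (-1) ^ r *
      PowerSeries.coeff r (eSeries (Finset.univ.erase l)
        (MvPolynomial.X : Fin n → MvPolynomial (Fin n) ℂ)) := by
  have h1 := aeval_esymm (A := ℂ) (MvPolynomial.X : Fin n → MvPolynomial (Fin n) ℂ) (r + 1)
  have h2 : eSeries Finset.univ (MvPolynomial.X : Fin n → MvPolynomial (Fin n) ℂ) =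
      eSeries (Finset.univ.erase l) MvPolynomial.X -
      PowerSeries.C (MvPolynomial.X l) * (PowerSeries.X * eSeries (Finset.univ.erase l)
        (MvPolynomial.X : Fin n → MvPolynomial (Fin n) ℂ)) := by
    rw [eSeries, ← Finset.mul_prod_erase Finset.univ _ (Finset.mem_univ l), ← eSeries]
    ring
  have h3 : ((-1 : MvPolynomial (Fin n) ℂ)) ^ (r + 1) = MvPolynomial.C ((-1) ^ (r + 1)) := by simp
  rw [MvPolynomial.aeval_X_left_apply] at h1
  rw [h1, h2, map_sub, PowerSeries.coeff_C_mul, PowerSeries.coeff_succ_X_mul, h3,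
    MvPolynomial.pderiv_C_mul, map_sub, Derivation.leibniz,
    pderiv_coeff_eSeries _ _ (Finset.notMem_erase _ _),
    pderiv_coeff_eSeries _ _ (Finset.notMem_erase _ _), MvPolynomial.pderiv_X_self]
  simp [pow_succ]

/-- The chain rule along `y ↦ e(y)`. -/
theorem pderiv_symHom {n : ℕ} (l : Fin n) (q : ERing n) :
    MvPolynomial.pderiv l (symHom n q) =
      ∑ i : Fin n, symHom n (MvPolynomial.pderiv i q) *
        MvPolynomial.pderiv l (MvPolynomial.esymm (Fin n) ℂ (i + 1)) := by
  induction q using MvPolynomial.induction_on with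
  | C a =>
    rw [← MvPolynomial.algebraMap_eq, AlgHom.commutes]
    simp [MvPolynomial.algebraMap_eq]
  | add f g hf hg => simp only [map_add, hf, hg, add_mul, Finset.sum_add_distrib]
  | mul_X f j hf =>
    have h1 : ∀ i : Fin n, symHom n (MvPolynomial.pderiv i (f * MvPolynomial.X j)) =
        (if i = j then symHom n f else 0) +
          MvPolynomial.esymm (Fin n) ℂ (j + 1) * symHom n (MvPolynomial.pderiv i f) := by
      intro i
      rw [Derivation.leibniz, smul_eq_mul, smul_eq_mul, map_add, map_mul, map_mul, symHom_X]
      split_ifs with h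
      · rw [h, MvPolynomial.pderiv_X_self, map_one, mul_one]
      · rw [MvPolynomial.pderiv_X_of_ne (Ne.symm h), map_zero, mul_zero]
    simp only [h1, add_mul, Finset.sum_add_distrib, ite_mul, zero_mul, Finset.sum_ite_eq',
      Finset.mem_univ, if_true]
    rw [map_mul, symHom_X, Derivation.leibniz, hf, smul_eq_mul, smul_eq_mul, Finset.mul_sum]
    simp only [mul_assoc]

/-- The derivative (n+k) y_l^{n+k-1} of p_{n+k} expands against the columns of `cofactorMatrix` in
two ways: by the chain rule, and by `sum_hVal_mul_cofactorMatrix`. The determinant is a Vandermonde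
determinant in the indeterminates, hence nonzero, so the coefficients agree. -/
theorem pderiv_p {n k : ℕ} (i : Fin n) :
    MvPolynomial.pderiv i (p n (n + k)) =
      MvPolynomial.C ((-1) ^ (i : ℕ) * ((n : ℂ) + k)) * h n (n + k - 1 - i) := by
  classical
  let M := cofactorMatrix (MvPolynomial.X : Fin n → MvPolynomial (Fin n) ℂ)
  have hM : M.det ≠ 0 := by
    rw [det_cofactorMatrix]
    exact alternant_rho_ne_zero (MvPolynomial.X_injective)
  -- The difference of the two coefficient vectors. The index is reversed because `cofactorMatrix`
  -- lists the coefficients in descending degree.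
  let v : Fin n → MvPolynomial (Fin n) ℂ := fun j =>
    symHom n ((MvPolynomial.C ((-1) ^ (n - 1 - (j : ℕ)))) *
      MvPolynomial.pderiv j.rev (p n (n + k)) -
      MvPolynomial.C ((n : ℂ) + k) * h n (k + j))
  have hv : Matrix.vecMul v M = 0 := by
    ext1 l
    have h1 := pderiv_symHom l (p n (n + k))
    rw [symHom_p, MvPolynomial.psum, map_sum, Finset.sum_eq_single l] at h1
    rotate_left
    · intro j _ hj
      rw [MvPolynomial.pderiv_pow, MvPolynomial.pderiv_X_of_ne hj, mul_zero]
    · simp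
    rw [MvPolynomial.pderiv_pow, MvPolynomial.pderiv_X_self, mul_one] at h1
    have h2 := sum_hVal_mul_cofactorMatrix (MvPolynomial.X : Fin n → MvPolynomial (Fin n) ℂ) l
      (n + k - 1)
    rw [← h2, Finset.mul_sum] at h1
    replace h1 := h1.trans (Equiv.sum_comp Fin.revPerm _).symm
    have h3 := sub_eq_zero.2 h1.symm
    rw [← Finset.sum_sub_distrib] at h3
    rw [Pi.zero_apply, ← h3, Matrix.vecMul, dotProduct]
    refine Finset.sum_congr rfl fun j _ => ?_
    have hj := j.2
    have h4 : ((n + k - 1 : ℕ) : ℤ) - (n - 1 : ℕ) + (j : ℕ) = ((k + j : ℕ) : ℤ) := by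
      push_cast; omega
    rw [h4, hVal_X, ← symHom_h, Fin.revPerm_apply, pderiv_esymm, Fin.val_rev,
      show n - (j + 1) = n - 1 - (j : ℕ) by omega]
    simp only [v, M, cofactorMatrix, Matrix.of_apply, map_sub, map_mul]
    have h5 : ∀ a, symHom n (MvPolynomial.C a) = MvPolynomial.C a := fun a =>
      (symHom n).commutes a
    rw [h5, h5]
    simp
    ring
  have hv0 : v = 0 := Matrix.eq_zero_of_vecMul_eq_zero hM hv
  have h6 : v i.rev = 0 := congrFun hv0 _
  have h7 := sub_eq_zero.1 ((map_eq_zero_iff _ (symHom_injective n)).1 h6)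
  rw [Fin.rev_rev, Fin.val_rev] at h7
  have hi := i.2
  rw [show n - 1 - (n - (i + 1)) = (i : ℕ) by omega,
    show k + (n - (i + 1)) = n + k - 1 - i by omega] at h7
  rw [map_mul, mul_assoc, ← h7, ← mul_assoc, ← map_mul, ← mul_pow]
  simp

/-- The generators match up to sign: as `i` runs from 0 to n-2, the degree n+k-1-i runs from n+k-1
down to k+1. -/
theorem potentialIdeal_eq_gepnerIdeal (n k : ℕ) : potentialIdeal n k = gepnerIdeal n k := by
  have key : ∀ i : Fin n, MvPolynomial.pderiv i (gepnerPotential n k) =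
      MvPolynomial.C ((-1) ^ (i : ℕ)) * h n (n + k - 1 - i) := by
    intro i
    have : ((n : ℂ) + k) ≠ 0 := by
      have := i.pos
      exact_mod_cast (by omega : n + k ≠ 0)
    rw [gepnerPotential, MvPolynomial.pderiv_C_mul, pderiv_p,
      ← mul_assoc, ← map_mul]
    congr 2
    field_simp
  apply le_antisymm
  · refine Ideal.span_le.2 (Set.insert_subset (Ideal.subset_span (Set.mem_insert _ _)) ?_)
    rintro q ⟨i, hi, rfl⟩
    rw [key]
    refine Ideal.mul_mem_left _ _ (Ideal.subset_span (Set.mem_insert_of_mem _ ⟨_, ?_, ?_, rfl⟩)) <;>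
    omega
  · refine Ideal.span_le.2 (Set.insert_subset (Ideal.subset_span (Set.mem_insert _ _)) ?_)
    rintro q ⟨r, hr1, hr2, rfl⟩
    have h1 := key ⟨n + k - 1 - r, by omega⟩
    have h2 : h n r = MvPolynomial.C ((-1) ^ (n + k - 1 - r)) *
        MvPolynomial.pderiv ⟨n + k - 1 - r, by omega⟩ (gepnerPotential n k) := by
      rw [h1, ← mul_assoc, ← map_mul, ← mul_pow]
      simp only [neg_mul_neg, one_mul, one_pow, map_one]
      congr 1
      omega
    rw [h2]
    refine Ideal.mul_mem_left _ _ (Ideal.subset_span (Set.mem_insert_of_mem _ ⟨_, ?_, rfl⟩))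
    simp only
    omega

/-! ### The complete symmetric polynomials lie in the Goodman–Wenzl ideal -/

/-- The hook with arm `a` (including the corner) and leg `J`. -/
def hook (n a J : ℕ) (i : Fin n) : ℕ := if (i : ℕ) = 0 then a else if (i : ℕ) ≤ J then 1 else 0

theorem hook_antitone (n a J : ℕ) : Antitone (hook n (a + 1) J) := by
  intro i j hij
  have hij' : (i : ℕ) ≤ j := hij
  unfold hook
  split_ifs <;> omega

/-- Moving the first row of the hook's matrix to position `J` makes the matrix upper triangular,
with diagonal entries 1 except for `g (a + J)` in row `J`; the entries of that row to the left
vanish by `hlt`. -/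
theorem eq_zero_of_det_hook_eq_zero {A : Type*} [CommRing A] (n : ℕ) [NeZero n] (a : ℕ)
    (J : Fin n) (g : ℤ → A)
    (hneg : ∀ r < 0, g r = 0) (h0 : g 0 = 1) (hlt : ∀ j : ℕ, j < J → g (a + j) = 0)
    (hdet : Matrix.det
      (Matrix.of fun i j : Fin n => g ((hook n a J i : ℤ) - (i : ℕ) + (j : ℕ))) = 0) :
    g (a + (J : ℕ)) = 0 := by
  let M : Matrix (Fin n) (Fin n) A :=
    Matrix.of fun i j : Fin n => g ((hook n a J i : ℤ) - (i : ℕ) + (j : ℕ))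
  have hrow : ∀ i j : Fin n, M (Fin.cycleRange J i) j =
      if i = J then g (a + (j : ℕ)) else g ((j : ℤ) - (i : ℕ)) := by
    intro i j
    simp only [M, Matrix.of_apply]
    rcases lt_trichotomy i J with hi | hi | hi
    · have hi' : (i : ℕ) < J := hi
      have h1 : ((Fin.cycleRange J i : Fin n) : ℕ) = i + 1 := by
        rw [Fin.coe_cycleRange_of_lt hi]
      rw [if_neg hi.ne]
      congr 1
      simp only [hook, h1]
      rw [if_neg (by omega), if_pos (by omega)]
      push_cast; ring
    · subst hi
      rw [if_pos rfl, Fin.cycleRange_self]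
      simp [hook]
    · have hi' : (J : ℕ) < i := hi
      rw [if_neg hi.ne', Fin.cycleRange_of_gt hi]
      congr 1
      simp only [hook]
      rw [if_neg (by omega), if_neg (by omega)]
      push_cast; ring
  have h1 : (M.submatrix (Fin.cycleRange J) id).det = g (a + (J : ℕ)) := by
    rw [Matrix.det_of_isUpperTriangular]
    · rw [Finset.prod_eq_single J]
      · rw [Matrix.submatrix_apply, id, hrow, if_pos rfl]
      · intro i _ hi
        rw [Matrix.submatrix_apply, id, hrow, if_neg hi, sub_self, h0]
      · simp
    · intro i j hij
      have hij' : (j : ℕ) < i := hij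
      rw [Matrix.submatrix_apply, id, hrow]
      split_ifs with hi
      · exact hlt j (hi ▸ hij')
      · exact hneg _ (by omega)
  rw [Matrix.det_permute, show M.det = 0 from hdet, mul_zero] at h1
  exact h1.symm

/-- Induction on J = r - (k+1). Since J ≤ n-2, the hook with arm k+1 and leg J has empty last row,
so its Schur polynomial is a generator; modulo the earlier h's it is ±h_r. -/
theorem gepnerIdeal_le_goodmanWenzlIdeal (n k : ℕ) [NeZero n] :
    gepnerIdeal n k ≤ goodmanWenzlIdeal n k := by
  refine Ideal.span_le.2 (Set.insert_subset (Ideal.subset_span (Set.mem_insert _ _)) ?_)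
  rintro q ⟨r, hr1, hr2, rfl⟩
  obtain ⟨J, rfl⟩ := Nat.exists_eq_add_of_le hr1
  induction J using Nat.strong_induction_on with
  | _ J ih =>
    have hJ : J < n := by omega
    have h1 : schurE (hook n (k + 1) J) ∈ goodmanWenzlIdeal n k := by
      refine Ideal.subset_span (Set.mem_insert_of_mem _
        ⟨hook n (k + 1) J, hook_antitone n k J, ?_, (isSchur_iff (hook_antitone n k J) _).2 rfl⟩)
      have h2 : ((⊤ : Fin n) : ℕ) = n - 1 := rfl
      simp only [hook, h2, Fin.val_zero]
      rw [if_pos True.intro, if_neg (by omega), if_neg (by omega), zero_add]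
    rw [SetLike.mem_coe, ← Ideal.Quotient.eq_zero_iff_mem]
    rw [← Ideal.Quotient.eq_zero_iff_mem, schurE, RingHom.map_det] at h1
    have h4 := eq_zero_of_det_hook_eq_zero n (k + 1) ⟨J, hJ⟩
      (fun r => Ideal.Quotient.mk (goodmanWenzlIdeal n k) (hInt n r))
      (fun r hr => by simp [hInt, hr]) (by simp [hInt_zero]) (fun j hj => by
        have := ih j hj (by omega) (by simp only at hj; omega)
        rw [SetLike.mem_coe, ← Ideal.Quotient.eq_zero_iff_mem] at this
        rw [hInt, if_neg (by omega), ← this]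
        congr 2) h1
    rw [hInt, if_neg (by omega)] at h4
    exact h4

/-! ### The fundamental alcove -/

/-- Descent on the sum of squares: if a_i - a_j > N, moving N from coordinate i to coordinate j
lowers it by 2N(a_i - a_j - N). The result lies, up to sorting, in the closed fundamental alcove. -/
theorem exists_alcove {n : ℕ} {N : ℤ} (hN : 0 < N) (a : Fin n → ℤ) :
    ∃ q : Fin n → ℤ, ∑ i, q i = 0 ∧ ∀ i j, (a i + N * q i) - (a j + N * q j) ≤ N := by
  obtain ⟨B, hB⟩ : ∃ B : ℕ, ∑ i, a i ^ 2 ≤ (B : ℤ) := by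
    generalize ∑ i, a i ^ 2 = s
    exact ⟨s.toNat, Int.self_le_toNat s⟩
  induction B generalizing a with
  | zero =>
    have h0 : ∑ i, a i ^ 2 = 0 := le_antisymm (by exact_mod_cast hB)
      (Finset.sum_nonneg fun i _ => sq_nonneg _)
    have h1 : ∀ i, a i = 0 := fun i => by
      have := (Finset.sum_eq_zero_iff_of_nonneg fun i _ => sq_nonneg (a i)).1 h0 i
        (Finset.mem_univ _)
      simpa using this
    exact ⟨0, by simp, fun i j => by simp [h1, hN.le]⟩
  | succ B ih =>
    by_cases h : ∀ i j, a i - a j ≤ N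
    · exact ⟨0, by simp, fun i j => by simpa using h i j⟩
    · push Not at h
      obtain ⟨i, j, hij⟩ := h
      have hne : i ≠ j := by rintro rfl; simp at hij; omega
      let d : Fin n → ℤ := fun t => (Pi.single j 1 : Fin n → ℤ) t - (Pi.single i 1 : Fin n → ℤ) t
      have hd : ∑ t, d t = 0 := by simp [d]
      have hd2 : ∑ t, d t ^ 2 = 2 := by
        have : ∀ t, d t ^ 2 = (Pi.single j 1 : Fin n → ℤ) t + (Pi.single i 1 : Fin n → ℤ) t := by
          intro t
          simp only [d, Pi.single_apply]
          split_ifs with h1 h2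
          · exact absurd (h2.symm.trans h1) hne
          all_goals simp
        simp [this, Finset.sum_add_distrib]
      have had : ∑ t, a t * d t = a j - a i := by
        simp [d, mul_sub, Finset.sum_sub_distrib, Pi.single_apply]
      have hsq : ∑ t, (a t + N * d t) ^ 2 = ∑ t, a t ^ 2 + 2 * N * (a j - a i) + N ^ 2 * 2 := by
        have h5 : ∑ t, (a t + N * d t) ^ 2 =
            ∑ t, a t ^ 2 + 2 * N * ∑ t, a t * d t + N ^ 2 * ∑ t, d t ^ 2 := by
          rw [Finset.mul_sum, Finset.mul_sum, ← Finset.sum_add_distrib, ← Finset.sum_add_distrib]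
          exact Finset.sum_congr rfl fun t _ => by ring
        rw [h5, had, hd2]
      obtain ⟨q, hq, hq'⟩ := ih (fun t => a t + N * d t) (by
        rw [hsq]
        have h3 : 0 < N * (a i - a j - N) := mul_pos hN (by omega)
        push_cast at hB
        have h4 : 2 * N * (a j - a i) + N ^ 2 * 2 = -2 * (N * (a i - a j - N)) := by ring
        omega)
      refine ⟨fun t => d t + q t, by rw [Finset.sum_add_distrib, hd, hq, add_zero], fun s t => ?_⟩
      have := hq' s t
      linarith

theorem exists_perm_strictAnti {n : ℕ} {a : Fin n → ℤ} (ha : Function.Injective a) :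
    ∃ w : Equiv.Perm (Fin n), StrictAnti fun i => a (w i) := by
  refine ⟨Tuple.sort (fun i => -a i), ?_⟩
  have h1 : Antitone fun i => a (Tuple.sort (fun i => -a i) i) := fun i j hij =>
    neg_le_neg_iff.1 (Tuple.monotone_sort (fun i => -a i) hij)
  exact h1.strictAnti_of_injective (ha.comp (Equiv.injective _))

/-- The sequence `b` plays the role of λ+ρ up to a constant: its gaps minus one are the labels, and
the sum defining the part telescopes. -/
theorem Weight.cast_part_eq {n k : ℕ} (m : Weight n k) (b : ℕ → ℤ)
    (hb : ∀ j : Fin n, (j : ℕ) + 1 < n → (m.1 j : ℤ) = b j - b (j + 1) - 1) (i : Fin n) :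
    (m.part i : ℤ) = b i - b (n - 1) - (n - 1 - (i : ℕ) : ℕ) := by
  have hi := i.2
  let f : ℕ → ℤ := fun j => if (i : ℕ) ≤ j ∧ j + 1 < n then b j - b (j + 1) - 1 else 0
  have h1 : (m.part i : ℤ) = ∑ j : Fin n, f j := by
    rw [Weight.part]
    push_cast
    refine Finset.sum_congr rfl fun j _ => ?_
    simp only [Fin.le_def, f]
    split_ifs with h
    · exact hb j h.2
    · simp
  rw [h1, Fin.sum_univ_eq_sum_range, ← Finset.sum_filter]
  have h2 : Finset.filter (fun j : ℕ => (i : ℕ) ≤ j ∧ j + 1 < n) (Finset.range n) =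
      Finset.Ico (i : ℕ) (n - 1) := by
    ext j
    simp only [Finset.mem_filter, Finset.mem_range, Finset.mem_Ico]
    omega
  rw [h2, Finset.sum_sub_distrib, Finset.sum_const, Nat.card_Ico, Finset.sum_Ico_eq_sum_range]
  have h3 := Finset.sum_range_sub' (fun t => b (i + t)) (n - 1 - i)
  rw [show (i : ℕ) + (n - 1 - i) = n - 1 by omega, add_zero] at h3
  rw [← h3]
  simp [add_assoc]

theorem Weight.cast_label_eq {n k : ℕ} (m : Weight n k) (i : Fin n) (h : (i : ℕ) + 1 < n) :
    (m.part i : ℤ) - m.part ⟨i + 1, h⟩ = m.1 i := by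
  let b : ℕ → ℤ := fun t => ∑ j ∈ Finset.Ico t (n - 1),
    ((if h : j < n then (m.1 ⟨j, h⟩ : ℤ) else 0) + 1)
  have hb : ∀ j : Fin n, (j : ℕ) + 1 < n → (m.1 j : ℤ) = b j - b (j + 1) - 1 := by
    intro j hj
    simp only [b]
    rw [Finset.sum_eq_sum_Ico_succ_bot (by omega), dif_pos j.2]
    ring
  rw [m.cast_part_eq b hb, m.cast_part_eq b hb, hb i h]
  push_cast
  have : ((n - 1 - (i : ℕ) : ℕ) : ℤ) = (n - 1 - ((i : ℕ) + 1) : ℕ) + 1 := by omega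
  rw [this]; ring

theorem Weight.part_last {n k : ℕ} (m : Weight n k) (i : Fin n) (h : ¬ (i : ℕ) + 1 < n) :
    m.part i = 0 := by
  rw [Weight.part]
  refine Finset.sum_eq_zero fun j _ => if_neg ?_
  rintro ⟨h1, h2⟩
  have : (i : ℕ) ≤ j := h1
  omega

theorem Weight.part_antitone {n k : ℕ} (m : Weight n k) : Antitone m.part := by
  intro i j hij
  rw [Weight.part, Weight.part]
  refine Finset.sum_le_sum fun t _ => ?_
  split_ifs with h1 h2 h2
  · exact le_rfl
  · exact absurd ⟨hij.trans h1.1, h1.2⟩ h2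
  · exact Nat.zero_le _
  · exact le_rfl

theorem Weight.part_le {n k : ℕ} (m : Weight n k) (i : Fin n) : m.part i ≤ k := by
  refine le_trans ?_ m.2.le
  rw [Weight.part]
  refine Finset.sum_le_sum fun t _ => ?_
  split_ifs
  · exact le_rfl
  · exact Nat.zero_le _

/-- The finite labels are differences of parts, and the level then fixes the affine label. -/
theorem Weight.part_injective {n k : ℕ} {m m' : Weight n k} (h : m.part = m'.part) : m = m' := by
  have h1 : ∀ i : Fin n, (i : ℕ) + 1 < n → m.1 i = m'.1 i := fun i hi => by
    have h2 := m.cast_label_eq i hi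
    have h3 := m'.cast_label_eq i hi
    rw [h] at h2
    exact_mod_cast h2.symm.trans h3
  apply Subtype.ext
  funext i
  by_cases hi : (i : ℕ) + 1 < n
  · exact h1 i hi
  · have h2 := m.2.trans m'.2.symm
    rw [← Finset.add_sum_erase _ _ (Finset.mem_univ i),
      ← Finset.add_sum_erase _ m'.1 (Finset.mem_univ i)] at h2
    have h3 : ∑ x ∈ Finset.univ.erase i, m.1 x = ∑ x ∈ Finset.univ.erase i, m'.1 x := by
      refine Finset.sum_congr rfl fun j hj => h1 j ?_
      have h4 : (j : ℕ) ≠ i := fun h => (Finset.mem_erase.1 hj).1 (Fin.ext h)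
      have := j.2
      omega
    omega

theorem Weight.part_vac (n k : ℕ) [NeZero n] : (Weight.vac n k).part = fun _ => 0 := by
  funext i
  rw [Weight.part]
  refine Finset.sum_eq_zero fun j _ => ?_
  split_ifs with h
  · refine Pi.single_eq_of_ne (fun h' => ?_) _
    have h1 : (j : ℕ) = n - 1 := congrArg Fin.val h'
    omega
  · rfl

theorem exists_weight_of_strictAnti {n k : ℕ} [NeZero n] {B : Fin n → ℤ} (hB : StrictAnti B)
    (hk : B 0 - B ⊤ < n + k) :
    ∃ m : Weight n k, ∀ i, B i = (addRho m.part i : ℕ) + B ⊤ := by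
  -- The extra value at `n` makes the affine label one more gap minus one. It is nonnegative by
  -- `hk`, and all gaps together telescope to `n + k`, so the labels sum to `k`.
  let b : ℕ → ℤ := fun i => if h : i < n then B ⟨i, h⟩ else B 0 - (n + k)
  have hn : 0 < n := Nat.pos_of_neZero n
  have hb : ∀ i < n, 0 ≤ b i - b (i + 1) - 1 := by
    intro i hi
    simp only [b, dif_pos hi]
    split_ifs with h
    · have : B ⟨i + 1, h⟩ < B ⟨i, hi⟩ := hB (show i < i + 1 by omega)
      omega
    · have : B ⊤ ≤ B ⟨i, hi⟩ := hB.antitone le_top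
      have h3 : (⟨i, hi⟩ : Fin n) = ⊤ := Fin.ext (show i = n - 1 by omega)
      rw [h3]
      omega
  have hcast : ∀ i : Fin n, (((b i - b (i + 1) - 1).toNat : ℕ) : ℤ) = b i - b (i + 1) - 1 :=
    fun i => Int.toNat_of_nonneg (hb i i.2)
  have hb0 : b 0 = B 0 := dif_pos hn
  have hbn : b n = B 0 - (n + k) := dif_neg (lt_irrefl n)
  let m : Weight n k := ⟨fun i => (b i - b (i + 1) - 1).toNat, by
    zify
    rw [Finset.sum_congr rfl fun i _ => hcast i,
      Fin.sum_univ_eq_sum_range (fun i => b i - b (i + 1) - 1), Finset.sum_sub_distrib,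
      Finset.sum_range_sub', hb0, hbn]
    simp⟩
  refine ⟨m, fun i => ?_⟩
  have h1 := m.cast_part_eq b (fun j _ => hcast j) i
  have h2 : b i = B i := dif_pos i.2
  have h3 : b (n - 1) = B ⊤ := dif_pos (by omega)
  rw [h2, h3] at h1
  simp only [addRho]
  push_cast
  rw [h1]
  ring

/-! ### Fusion points -/

/-- The points of the fusion variety: `n` distinct numbers with product `1` and a common
`(n + k)`-th power. -/
structure IsFusionPoint (n k : ℕ) (y : Fin n → ℂ) : Prop where
  injective : Function.Injective y
  pow_eq : ∀ i j, y i ^ (n + k) = y j ^ (n + k)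
  prod_eq : ∏ i, y i = 1

/-- The alternant with integral exponents. -/
def zAlternant {n : ℕ} (y : Fin n → ℂ) (a : Fin n → ℤ) : ℂ :=
  Matrix.det (Matrix.of fun i l => y l ^ a i)

theorem zAlternant_natCast {n : ℕ} (y : Fin n → ℂ) (a : Fin n → ℕ) :
    zAlternant y (fun i => (a i : ℤ)) = alternant y a := by
  simp [zAlternant, alternant]

theorem zAlternant_comp_perm {n : ℕ} (y : Fin n → ℂ) (a : Fin n → ℤ) (w : Equiv.Perm (Fin n)) :
    zAlternant y (fun i => a (w i)) = (Equiv.Perm.sign w : ℤ) * zAlternant y a := by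
  rw [zAlternant, zAlternant, ← Matrix.det_permute]
  rfl

theorem zAlternant_eq_zero_of_eq {n : ℕ} {y : Fin n → ℂ} {a : Fin n → ℤ} {i j : Fin n} (hij : i ≠ j)
    (h : a i = a j) : zAlternant y a = 0 :=
  Matrix.det_zero_of_row_eq hij (by ext l; simp [h])

theorem prod_zpow_eq_one {n : ℕ} {y : Fin n → ℂ} (hy : ∏ i, y i = 1) (t : ℤ) :
    ∏ i, y i ^ t = 1 := by rw [Finset.prod_zpow, hy, one_zpow]

namespace IsFusionPoint

variable {n k : ℕ} {y : Fin n → ℂ}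

theorem ne_zero (hy : IsFusionPoint n k y) (i : Fin n) : y i ≠ 0 := fun h =>
  one_ne_zero (hy.prod_eq.symm.trans (Finset.prod_eq_zero (Finset.mem_univ i) h))

/-- The shift multiplies column `l` by `y_l ^ t`, and these factors have product 1. -/
theorem zAlternant_add_const (hy : IsFusionPoint n k y) (a : Fin n → ℤ) (t : ℤ) :
    zAlternant y (fun i => a i + t) = zAlternant y a := by
  have h := Matrix.det_mul_row (fun l => y l ^ t) (Matrix.of fun i l => y l ^ a i)
  rw [prod_zpow_eq_one hy.prod_eq, one_mul] at h
  rw [zAlternant, zAlternant, ← h]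
  congr 1
  ext i l
  simp [zpow_add₀ (hy.ne_zero l), mul_comm]

/-- All coordinates have the same (n+k)-th power c, so the shift multiplies row `i` by `c ^ q i`. -/
theorem zAlternant_add_mul (hy : IsFusionPoint n k y) (a q : Fin n → ℤ) :
    (∃ c : ℂ, c ≠ 0 ∧ zAlternant y (fun i => a i + (n + k : ℕ) * q i) =
      c ^ (∑ i, q i) * zAlternant y a) := by
  rcases n.eq_zero_or_pos with rfl | hn
  · exact ⟨1, one_ne_zero, by simp [zAlternant]⟩
  refine ⟨y ⟨0, hn⟩ ^ (n + k), pow_ne_zero _ (hy.ne_zero _), ?_⟩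
  have h := Matrix.det_mul_column (fun i => (y ⟨0, hn⟩ ^ (n + k)) ^ q i)
    (Matrix.of fun i l => y l ^ a i)
  have h2 : ∏ i, (y ⟨0, hn⟩ ^ (n + k)) ^ q i = (y ⟨0, hn⟩ ^ (n + k)) ^ (∑ i, q i) := by
    generalize (Finset.univ : Finset (Fin n)) = s
    induction s using Finset.induction_on with
    | empty => simp
    | insert i s hi ih =>
      rw [Finset.prod_insert hi, Finset.sum_insert hi, ih,
        zpow_add₀ (pow_ne_zero _ (hy.ne_zero _))]
  rw [h2] at h
  rw [zAlternant, zAlternant, ← h]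
  congr 1
  ext i l
  simp only [Matrix.of_apply]
  rw [zpow_add₀ (hy.ne_zero l), zpow_mul, zpow_natCast, hy.pow_eq l ⟨0, hn⟩, mul_comm]

theorem zAlternant_add_mul_of_sum_eq_zero (hy : IsFusionPoint n k y) (a q : Fin n → ℤ)
    (hq : ∑ i, q i = 0) : zAlternant y (fun i => a i + (n + k : ℕ) * q i) = zAlternant y a := by
  obtain ⟨c, _, h⟩ := hy.zAlternant_add_mul a q
  rw [h, hq, zpow_zero, one_mul]

/-- The affine wall: raising the exponent `a j` by `n + k` makes two rows equal and costs only a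
nonzero factor. -/
theorem zAlternant_eq_zero_of_sub_eq (hy : IsFusionPoint n k y) {a : Fin n → ℤ} {i j : Fin n}
    (hij : i ≠ j) (h : a i - a j = (n + k : ℕ)) : zAlternant y a = 0 := by
  obtain ⟨c, hc, h1⟩ := hy.zAlternant_add_mul a (Pi.single j 1)
  rw [zAlternant_eq_zero_of_eq hij (by simp [hij]; push_cast at h; omega)] at h1
  exact (mul_eq_zero.1 h1.symm).resolve_left (zpow_ne_zero _ hc)

theorem alternant_rho_ne_zero (hy : IsFusionPoint n k y) : alternant y (addRho fun _ => 0) ≠ 0 :=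
  SuFusion.alternant_rho_ne_zero hy.injective

end IsFusionPoint

/-- Translate the exponents into the closed alcove. On a wall the alternant vanishes; in the
interior, sorting costs a sign and yields some μ+ρ up to a constant. Sign and weight depend on the
exponents alone, hence serve all fusion points at once. -/
theorem exists_alternant_eq (n k : ℕ) [NeZero n] (a : Fin n → ℤ) :
    ∃ (z : ℤ) (m : Weight n k), ∀ y, IsFusionPoint n k y →
      zAlternant y a = z * alternant y (addRho m.part) := by
  have hn : 0 < n := Nat.pos_of_neZero n
  obtain ⟨q, hq, hle⟩ := exists_alcove (N := (n + k : ℕ)) (by exact_mod_cast (by omega)) a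
  let b : Fin n → ℤ := fun i => a i + (n + k : ℕ) * q i
  have hab : ∀ y, IsFusionPoint n k y → zAlternant y a = zAlternant y b := fun y hy =>
    (hy.zAlternant_add_mul_of_sum_eq_zero a q hq).symm
  by_cases h1 : ∃ i j, i ≠ j ∧ (b i = b j ∨ b i - b j = (n + k : ℕ))
  · obtain ⟨i, j, hij, h | h⟩ := h1
    · exact ⟨0, Weight.vac n k, fun y hy => by
        rw [hab y hy, zAlternant_eq_zero_of_eq hij h]; simp⟩
    · exact ⟨0, Weight.vac n k, fun y hy => by
        rw [hab y hy, hy.zAlternant_eq_zero_of_sub_eq hij h]; simp⟩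
  · push Not at h1
    have hb : Function.Injective b := fun i j h => by
      by_contra hij
      exact (h1 i j hij).1 h
    obtain ⟨w, hw⟩ := exists_perm_strictAnti hb
    obtain ⟨m, hm⟩ := exists_weight_of_strictAnti (k := k) hw (by
      have h2 := hle (w 0) (w ⊤)
      rcases eq_or_ne (w 0) (w ⊤) with h | h
      · rw [h, sub_self]; exact_mod_cast (by omega)
      · have h3 := (h1 _ _ h).2
        simp only [b] at h3 ⊢
        push_cast at h2 h3 ⊢
        omega)
    refine ⟨(Equiv.Perm.sign w : ℤ), m, fun y hy => ?_⟩
    have h4 := zAlternant_comp_perm y b w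
    rw [funext hm, hy.zAlternant_add_const, zAlternant_natCast] at h4
    rw [h4, hab y hy, ← mul_assoc, ← Int.cast_mul, ← Units.val_mul, Int.units_mul_self]
    simp

/-- By symmetry `f` may be expanded with its variables permuted by `w` inside the `w`-th term of the
Leibniz formula; each monomial then just shifts the exponents. -/
theorem aeval_mul_zAlternant {n : ℕ} {f : MvPolynomial (Fin n) ℂ} (hf : f.IsSymmetric)
    {y : Fin n → ℂ} (hy : ∀ i, y i ≠ 0) (a : Fin n → ℤ) :
    MvPolynomial.aeval y f * zAlternant y a =
      ∑ b ∈ f.support, f.coeff b * zAlternant y (fun i => a i + (b i : ℤ)) := by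
  have h1 : ∀ w : Equiv.Perm (Fin n), MvPolynomial.aeval y f =
      ∑ b ∈ f.support, f.coeff b * ∏ l, y l ^ b (w l) := by
    intro w
    conv_lhs => rw [← hf w.symm]
    rw [MvPolynomial.aeval_rename, MvPolynomial.aeval_def, MvPolynomial.eval₂_eq']
    refine Finset.sum_congr rfl fun b _ => ?_
    rw [← Equiv.prod_comp w.symm (fun l => y l ^ b (w l))]
    simp
  have h2 : ∀ a : Fin n → ℤ, zAlternant y a =
      ∑ w : Equiv.Perm (Fin n), (Equiv.Perm.sign w : ℤ) * ∏ l, y l ^ a (w l) := fun a => by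
    rw [zAlternant, Matrix.det_apply']; rfl
  simp only [h2, Finset.mul_sum]
  rw [Finset.sum_comm]
  refine Finset.sum_congr rfl fun w _ => ?_
  rw [h1 w, Finset.sum_mul]
  refine Finset.sum_congr rfl fun b _ => ?_
  simp only [zpow_add₀ (hy _), Finset.prod_mul_distrib, zpow_natCast]
  ring

/-- On the fusion points every symmetric polynomial is a combination of the Schur polynomials
of the weights of level `k`, with coefficients in the ring of its coefficients. -/
theorem exists_aeval_eq_sum (n k : ℕ) [NeZero n] (A : Subring ℂ) {f : MvPolynomial (Fin n) ℂ}
    (hf : f.IsSymmetric) (hA : ∀ b, f.coeff b ∈ A) :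
    ∃ c : Weight n k → ℂ, (∀ m, c m ∈ A) ∧ ∀ y, IsFusionPoint n k y →
      MvPolynomial.aeval y f = ∑ m, c m * jacobiTrudi m.part y := by
  -- After multiplication by the alternant of ρ, the monomial `b` contributes the alternant with
  -- exponents ρ+b, which straightens; division by the alternant of ρ turns the result into Schur
  -- polynomials.
  choose z m hzm using fun b : Fin n →₀ ℕ =>
    exists_alternant_eq n k (fun i => (addRho (fun _ => 0) i : ℤ) + (b i : ℤ))
  refine ⟨fun l => ∑ b ∈ f.support, if m b = l then f.coeff b * z b else 0, fun l => ?_,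
    fun y hy => ?_⟩
  · refine sum_mem fun b _ => ?_
    split_ifs
    · exact mul_mem (hA b) (intCast_mem A _)
    · exact zero_mem A
  · have h1 := aeval_mul_zAlternant hf hy.ne_zero (fun i => (addRho (fun _ => 0) i : ℤ))
    rw [zAlternant_natCast] at h1
    refine mul_right_cancel₀ hy.alternant_rho_ne_zero ?_
    rw [h1, Finset.sum_mul]
    simp only [mul_assoc, jacobiTrudi_mul_alternant, Finset.sum_mul]
    rw [Finset.sum_comm]
    refine Finset.sum_congr rfl fun b _ => ?_
    simp only [ite_mul, zero_mul, Finset.sum_ite_eq, Finset.mem_univ, if_true]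
    rw [hzm b y hy, mul_assoc]

theorem schur_mem_range_map {n : ℕ} (lam : Fin n → ℕ) :
    schur lam ∈ (MvPolynomial.map (σ := Fin n) (Int.castRingHom ℂ)).range := by
  classical
  rw [schur]
  exact sum_mem fun T _ => prod_mem fun c _ => ⟨MvPolynomial.X (T c), by simp⟩

theorem symHom_schurE_eq_schur {n : ℕ} {lam : Fin n → ℕ} (hl : Antitone lam) :
    symHom n (schurE lam) = schur lam := by
  rw [symHom_schurE, jacobiTrudi_eq_tableauSum lam hl, schur_eq_tableauSum]

/-- Tableau sums have integral coefficients, and straightening keeps them integral. This is the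
source of the integrality of the fusion coefficients. -/
theorem exists_int_schur_mul (n k : ℕ) [NeZero n] (l m : Weight n k) :
    ∃ c : Weight n k → ℤ, ∀ y, IsFusionPoint n k y →
      jacobiTrudi l.part y * jacobiTrudi m.part y = ∑ r, (c r : ℂ) * jacobiTrudi r.part y := by
  have h1 := mul_mem (schur_mem_range_map l.part) (schur_mem_range_map m.part)
  obtain ⟨g, hg⟩ := h1
  have h2 : schur l.part * schur m.part = symHom n (schurE l.part * schurE m.part) := by
    rw [map_mul, symHom_schurE_eq_schur l.part_antitone, symHom_schurE_eq_schur m.part_antitone]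
  obtain ⟨c, hc, hc'⟩ := exists_aeval_eq_sum n k (Int.castRingHom ℂ).range
    (symHom_isSymmetric (schurE l.part * schurE m.part)) (fun b => by
      rw [← h2, ← hg]
      exact ⟨g.coeff b, (MvPolynomial.coeff_map _ _ _).symm⟩)
  choose z hz using hc
  refine ⟨z, fun y hy => ?_⟩
  rw [← evalAt_schurE, ← evalAt_schurE, ← map_mul, evalAt_apply, hc' y hy]
  refine Finset.sum_congr rfl fun r _ => ?_
  rw [← hz r]; rfl

/-! ### The zeros of the ideal -/

section
variable {R : Type*} [CommRing R] {n k : ℕ}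

/-- The expansion of y_l^{n+k} involves only h_{k+1}, …, h_{n+k}; all but the last vanish, and the
last has coefficient 1. A general ring is allowed so that the variables modulo an ideal can be
inserted. -/
theorem pow_eq_hVal {y : Fin n → R} (hy : ∀ r : ℕ, k + 1 ≤ r → r + 1 ≤ n + k → hVal y r = 0)
    (l : Fin n) : y l ^ (n + k) = hVal y (n + k : ℕ) := by
  have hl := l.2
  rw [← sum_hVal_mul_cofactorMatrix y l (n + k), Finset.sum_eq_single ⟨n - 1, by omega⟩]
  · have h1 : ((n + k : ℕ) : ℤ) - (n - 1 : ℕ) + ((⟨n - 1, by omega⟩ : Fin n) : ℕ) =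
        (n + k : ℕ) := by
      simp
    rw [h1]
    simp [cofactorMatrix, coeff_eSeries]
  · intro j _ hj
    have hj' : (j : ℕ) ≠ n - 1 := fun h => hj (Fin.ext h)
    have := j.2
    have h1 : ((n + k : ℕ) : ℤ) - (n - 1 : ℕ) + (j : ℕ) = (k + 1 + j : ℕ) := by omega
    rw [h1, hy _ (by omega) (by omega), zero_mul]
  · simp

theorem pow_mul_eq_one {y : Fin n → R}
    (hy : ∀ r : ℕ, k + 1 ≤ r → r + 1 ≤ n + k → hVal y r = 0) (hprod : ∏ i, y i = 1) (l : Fin n) :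
    y l ^ ((n + k) * n) = 1 := by
  have h1 : ∏ i, y i ^ (n + k) = 1 := by rw [Finset.prod_pow, hprod, one_pow]
  simp only [pow_eq_hVal hy, Finset.prod_const, Finset.card_univ, Fintype.card_fin] at h1
  rw [pow_mul, pow_eq_hVal hy, h1]

/-- Remove the two equal factors: a polynomial of degree n-2 times the series of the h_r is the
square of a geometric series. In degree n+k-1 the square has coefficient (n+k) y_i^{n+k-1}, while
the product involves only h_{k+1}, …, h_{n+k-1}. -/
theorem natCast_mul_pow_eq_zero {y : Fin n → R}
    (hy : ∀ r : ℕ, k + 1 ≤ r → r + 1 ≤ n + k → hVal y r = 0) {i j : Fin n} (hij : i ≠ j)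
    (h : y i = y j) : ((n + k : ℕ) : R) * y i ^ (n + k - 1) = 0 := by
  classical
  have hn : 2 ≤ n := by
    have h1 : (i : ℕ) ≠ j := fun h => hij (Fin.ext h)
    have := i.2
    have := j.2
    omega
  have h1 : eSeries ((Finset.univ.erase i).erase j) y * hSeries Finset.univ y =
      PowerSeries.mk (fun a => y i ^ a) * PowerSeries.mk (fun a => y i ^ a) := by
    rw [hSeries, ← Finset.mul_prod_erase Finset.univ _ (Finset.mem_univ i),
      ← Finset.mul_prod_erase (Finset.univ.erase i) _
        (Finset.mem_erase.2 ⟨hij.symm, Finset.mem_univ j⟩), ← hSeries, ← h]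
    rw [mul_left_comm, mul_left_comm (eSeries _ _), eSeries_mul_hSeries, mul_one]
  have h2 := congrArg (PowerSeries.coeff (n + k - 1)) h1
  rw [PowerSeries.coeff_mul, PowerSeries.coeff_mul, Finset.sum_eq_zero] at h2
  · rw [Finset.sum_congr rfl (g := fun _ => y i ^ (n + k - 1)) (fun p hp => by
      rw [PowerSeries.coeff_mk, PowerSeries.coeff_mk, ← pow_add,
        Finset.HasAntidiagonal.mem_antidiagonal.1 hp]),
      Finset.sum_const, Finset.Nat.card_antidiagonal, nsmul_eq_mul] at h2
    rw [show n + k - 1 + 1 = n + k by omega] at h2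
    exact h2.symm
  · intro p hp
    rw [Finset.HasAntidiagonal.mem_antidiagonal] at hp
    by_cases h3 : n - 2 < p.1
    · rw [coeff_eSeries_eq_zero, zero_mul]
      rw [Finset.card_erase_of_mem (Finset.mem_erase.2 ⟨hij.symm, Finset.mem_univ j⟩),
        Finset.card_erase_of_mem (Finset.mem_univ i), Finset.card_univ, Fintype.card_fin]
      omega
    · rw [← hVal_natCast, hy _ (by omega) (by omega), mul_zero]

end

theorem evalAt_eq_zero_of_mem {n k : ℕ} {y : Fin n → ℂ} (hprod : ∏ i, y i = 1)
    (hy : ∀ r : ℕ, k + 1 ≤ r → r + 1 ≤ n + k → hVal y r = 0) {q : ERing n}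
    (hq : q ∈ gepnerIdeal n k) : evalAt y q = 0 := by
  have h1 : gepnerIdeal n k ≤ RingHom.ker (evalAt y) := by
    refine Ideal.span_le.2 (Set.insert_subset ?_ ?_)
    · rw [SetLike.mem_coe, RingHom.mem_ker, map_sub, evalAt_e, hprod, map_one, sub_self]
    · rintro q ⟨r, hr1, hr2, rfl⟩
      rw [SetLike.mem_coe, RingHom.mem_ker, evalAt_h, hy r hr1 hr2]
  exact h1 hq

theorem isFusionPoint_of_evalAt_eq_zero {n k : ℕ} {y : Fin n → ℂ}
    (hy : ∀ q ∈ gepnerIdeal n k, evalAt y q = 0) : IsFusionPoint n k y := by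
  have hprod : ∏ i, y i = 1 := by
    have := hy _ (Ideal.subset_span (Set.mem_insert _ _))
    rwa [map_sub, evalAt_e, map_one, sub_eq_zero] at this
  have hh : ∀ r : ℕ, k + 1 ≤ r → r + 1 ≤ n + k → hVal y r = 0 := fun r hr1 hr2 => by
    have := hy _ (Ideal.subset_span (Set.mem_insert_of_mem _ ⟨r, hr1, hr2, rfl⟩))
    rwa [evalAt_h] at this
  refine ⟨fun i j hij => ?_, fun i j => by rw [pow_eq_hVal hh, pow_eq_hVal hh], hprod⟩
  by_contra hne
  have h1 := natCast_mul_pow_eq_zero hh hne hij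
  have h2 : y i ≠ 0 := fun h =>
    one_ne_zero (hprod.symm.trans (Finset.prod_eq_zero (Finset.mem_univ i) h))
  refine mul_ne_zero (Nat.cast_ne_zero.2 ?_) (pow_ne_zero _ h2) h1
  have := i.2
  omega

/-- Converse of `pow_eq_hVal`: the common power c has the coefficient vectors (h_{k+1}, …, h_{n+k})
and (0, …, 0, c) with respect to `cofactorMatrix`, which is invertible for distinct coordinates. -/
theorem IsFusionPoint.hVal_eq_zero {n k : ℕ} {y : Fin n → ℂ} (hy : IsFusionPoint n k y) (r : ℕ)
    (hr1 : k + 1 ≤ r) (hr2 : r + 1 ≤ n + k) : hVal y r = 0 := by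
  have hn : 0 < n := by omega
  let c := y ⟨0, hn⟩ ^ (n + k)
  let v : Fin n → ℂ := fun j => hVal y (k + 1 + j : ℕ) - if (j : ℕ) = n - 1 then c else 0
  have hM : (cofactorMatrix y).det ≠ 0 := by
    rw [det_cofactorMatrix]
    exact hy.alternant_rho_ne_zero
  have hv : Matrix.vecMul v (cofactorMatrix y) = 0 := by
    ext1 l
    have h1 := sum_hVal_mul_cofactorMatrix y l (n + k)
    rw [hy.pow_eq l ⟨0, hn⟩] at h1
    simp only [Matrix.vecMul, dotProduct, v, sub_mul, Finset.sum_sub_distrib, Pi.zero_apply]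
    rw [sub_eq_zero, Finset.sum_eq_single (⟨n - 1, by omega⟩ : Fin n) (f := fun j : Fin n =>
      (if (j : ℕ) = n - 1 then c else 0) * cofactorMatrix y j l)]
    · rw [if_pos rfl]
      simp only [cofactorMatrix, Matrix.of_apply, Nat.sub_self, constantCoeff_eSeries, mul_one]
      refine Eq.trans ?_ h1
      refine Finset.sum_congr rfl fun j _ => ?_
      have h2 : ((n + k : ℕ) : ℤ) - (n - 1 : ℕ) + (j : ℕ) = (k + 1 + j : ℕ) := by omega
      rw [h2]; rfl
    · intro j _ hj
      rw [if_neg (fun h => hj (Fin.ext h)), zero_mul]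
    · simp
  have h3 := congrFun (Matrix.eq_zero_of_vecMul_eq_zero hM hv) ⟨r - (k + 1), by omega⟩
  simp only [v, Pi.zero_apply] at h3
  rw [if_neg (by omega), sub_zero, show k + 1 + (r - (k + 1)) = r by omega] at h3
  exact h3

theorem IsFusionPoint.evalAt_eq_zero {n k : ℕ} {y : Fin n → ℂ} (hy : IsFusionPoint n k y)
    {q : ERing n} (hq : q ∈ gepnerIdeal n k) : evalAt y q = 0 :=
  evalAt_eq_zero_of_mem hy.prod_eq hy.hVal_eq_zero hq

/-! ### The ideal is the vanishing ideal of its zeros -/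

-- Consequently, if x^M = 1, then x acts on the value at x of the Lagrange polynomial of ω as the
-- scalar ω.
open Polynomial in
theorem X_pow_sub_one_dvd_mul_basis {M : ℕ} (hM : 0 < M) {ω : ℂ}
    (hω : ω ∈ nthRootsFinset M (1 : ℂ)) :
    (X ^ M - 1 : ℂ[X]) ∣ (X - C ω) * Lagrange.basis (nthRootsFinset M (1 : ℂ)) id ω := by
  rw [X_pow_sub_one_eq_prod hM (Complex.isPrimitiveRoot_exp M hM.ne'),
    ← Finset.mul_prod_erase _ _ hω, Lagrange.basis]
  refine mul_dvd_mul_left _ (Finset.prod_dvd_prod_of_dvd _ _ fun j _ => ?_)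
  rw [Lagrange.basisDivisor]
  exact dvd_mul_left _ _

/-- An ideal over which all variables are roots of unity is a vanishing ideal. -/
theorem mem_of_forall_aeval_eq_zero {ι : Type*} [Fintype ι] [DecidableEq ι] {M : ℕ} (hM : 0 < M)
    (J : Ideal (MvPolynomial ι ℂ)) (hJ : ∀ i, (MvPolynomial.X i ^ M - 1 : MvPolynomial ι ℂ) ∈ J)
    {f : MvPolynomial ι ℂ}
    (hf : ∀ y : ι → ℂ, (∀ g ∈ J, MvPolynomial.aeval y g = 0) → MvPolynomial.aeval y f = 0) :
    f ∈ J := by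
  let s := Polynomial.nthRootsFinset M (1 : ℂ)
  let x : ι → MvPolynomial ι ℂ ⧸ J := fun i => Ideal.Quotient.mk J (MvPolynomial.X i)
  have hx : ∀ i, x i ^ M = 1 := fun i => by
    have := Ideal.Quotient.eq_zero_iff_mem.2 (hJ i)
    rwa [map_sub, map_pow, map_one, sub_eq_zero] at this
  -- These elements sum to 1, and every `g` acts on `ε y` as the scalar `g(y)`: the quotient splits
  -- along a finite grid of points.
  let ε : (ι → ℂ) → MvPolynomial ι ℂ ⧸ J := fun y =>
    ∏ i, Polynomial.aeval (x i) (Lagrange.basis s id (y i))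
  have hs : s.Nonempty := ⟨1, (Polynomial.mem_nthRootsFinset hM _).2 (one_pow _)⟩
  have hsum : ∑ y ∈ Fintype.piFinset (fun _ : ι => s), ε y = 1 := by
    simp only [ε]
    rw [← Finset.prod_univ_sum (fun _ => s)
      (fun i ω => Polynomial.aeval (x i) (Lagrange.basis s id ω))]
    refine Finset.prod_eq_one fun i _ => ?_
    rw [← map_sum, Lagrange.sum_basis Function.injective_id.injOn hs, map_one]
  have hε : ∀ y ∈ Fintype.piFinset (fun _ : ι => s), ∀ g : MvPolynomial ι ℂ,
      Ideal.Quotient.mk J g * ε y = algebraMap ℂ _ (MvPolynomial.aeval y g) * ε y := by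
    intro y hy g
    induction g using MvPolynomial.induction_on with
    | C a =>
      rw [MvPolynomial.aeval_C]; rfl
    | add g g' hg hg' => rw [map_add, map_add, map_add, add_mul, add_mul, hg, hg']
    | mul_X g i hg =>
      have h1 : x i * ε y = algebraMap ℂ _ (y i) * ε y := by
        obtain ⟨u, hu⟩ := X_pow_sub_one_dvd_mul_basis hM (Fintype.mem_piFinset.1 hy i)
        have h2 := congrArg (Polynomial.aeval (x i)) hu
        simp only [map_mul, map_sub, map_pow, map_one, Polynomial.aeval_X, Polynomial.aeval_C, hx,
          sub_self, zero_mul] at h2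
        rw [← sub_eq_zero, ← sub_mul]
        simp only [ε]
        rw [← Finset.mul_prod_erase _ _ (Finset.mem_univ i), ← mul_assoc, h2, zero_mul]
      rw [map_mul, map_mul, map_mul, mul_assoc]
      change _ * (x i * ε y) = _
      rw [h1, mul_left_comm, hg, MvPolynomial.aeval_X]
      ring
  rw [← Ideal.Quotient.eq_zero_iff_mem, ← mul_one (Ideal.Quotient.mk J f), ← hsum, Finset.mul_sum]
  refine Finset.sum_eq_zero fun y hy => ?_
  rw [hε y hy]
  by_cases h : ∀ g ∈ J, MvPolynomial.aeval y g = 0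
  · rw [hf y h, map_zero, zero_mul]
  -- Off the zero set of `J` some `g` in `J` acts on `ε y` both as zero and as a nonzero scalar, so
  -- `ε y = 0`.
  · push Not at h
    obtain ⟨g, hg, hne⟩ := h
    have h1 := hε y hy g
    rw [Ideal.Quotient.eq_zero_iff_mem.2 hg, zero_mul] at h1
    have h2 : ε y = algebraMap ℂ _ (MvPolynomial.aeval y g)⁻¹ *
        (algebraMap ℂ _ (MvPolynomial.aeval y g) * ε y) := by
      rw [← mul_assoc, ← map_mul, inv_mul_cancel₀ hne, map_one, one_mul]
    rw [h2, ← h1, mul_zero, mul_zero]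

/-- Extension to `ℂ[y_1, …, y_n]` and contraction does not change an ideal. -/
theorem mem_of_symHom_mem_map {n : ℕ} (I : Ideal (ERing n)) {q : ERing n}
    (hq : symHom n q ∈ I.map (symHom n)) : q ∈ I := by
  -- The sum over S_n is linear over the symmetric polynomials, so it maps the extended ideal back
  -- into `I`; on symmetric polynomials it is multiplication by n!.
  let avg : MvPolynomial (Fin n) ℂ →ₗ[ℂ] MvPolynomial (Fin n) ℂ :=
    ∑ w : Equiv.Perm (Fin n), (MvPolynomial.rename w).toLinearMap
  have havg : ∀ f, avg f = ∑ w : Equiv.Perm (Fin n), MvPolynomial.rename w f := fun f => by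
    simp [avg, LinearMap.sum_apply]
  have hsymm : ∀ f, (avg f).IsSymmetric := fun f u => by
    rw [havg, map_sum]
    refine Fintype.sum_equiv (Equiv.mulLeft u) _ _ fun w => ?_
    rw [MvPolynomial.rename_rename]; rfl
  have hmul : ∀ f g, avg (f * symHom n g) = avg f * symHom n g := fun f g => by
    rw [havg, havg, Finset.sum_mul]
    refine Finset.sum_congr rfl fun w _ => ?_
    rw [map_mul, symHom_isSymmetric g w]
  -- The multiplier `b` is quantified so that the claim survives multiplication by arbitrary
  -- polynomials in the induction over the span.
  have key : ∀ f ∈ I.map (symHom n), ∀ b, ∃ g ∈ I, avg (b * f) = symHom n g := by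
    intro f hf
    refine Submodule.span_induction (p := fun f _ => ∀ b, ∃ g ∈ I, avg (b * f) = symHom n g)
      ?_ ?_ ?_ ?_ hf
    · rintro _ ⟨g, hg, rfl⟩ b
      obtain ⟨a, ha⟩ := exists_symHom_eq (hsymm b)
      refine ⟨a * g, I.mul_mem_left _ hg, ?_⟩
      rw [map_mul (symHom n), ha]
      exact hmul b g
    · intro b
      exact ⟨0, I.zero_mem, by simp⟩
    · intro f f' _ _ hf hf' b
      obtain ⟨g, hg, h⟩ := hf b
      obtain ⟨g', hg', h'⟩ := hf' b
      exact ⟨g + g', I.add_mem hg hg', by rw [mul_add, map_add, map_add, h, h']⟩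
    · intro a f _ hf b
      obtain ⟨g, hg, h⟩ := hf (b * a)
      exact ⟨g, hg, by rw [smul_eq_mul, ← mul_assoc, h]⟩
  obtain ⟨g, hg, h⟩ := key _ hq 1
  rw [hmul, havg] at h
  simp only [map_one, Finset.sum_const, Finset.card_univ, Fintype.card_perm, Fintype.card_fin]
    at h
  have hfac : ((n.factorial : ℕ) : ℂ) ≠ 0 := Nat.cast_ne_zero.2 n.factorial_ne_zero
  have h1 : g = MvPolynomial.C ((n.factorial : ℕ) : ℂ) * q := by
    apply symHom_injective
    rw [← h, map_mul, nsmul_one]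
    congr 1
    simp
  have h2 : q = MvPolynomial.C ((n.factorial : ℂ))⁻¹ * g := by
    rw [h1, ← mul_assoc, ← map_mul, inv_mul_cancel₀ hfac, map_one, one_mul]
  rw [h2]
  exact I.mul_mem_left _ hg

/-- Applied to the classes of the variables, `pow_mul_eq_one` makes them roots of unity modulo the
extended ideal, which is therefore a vanishing ideal. Its zeros are fusion points, and contraction
returns the original ideal. -/
theorem mem_gepnerIdeal_iff {n k : ℕ} [NeZero n] (q : ERing n) :
    q ∈ gepnerIdeal n k ↔ ∀ y, IsFusionPoint n k y → evalAt y q = 0 := by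
  refine ⟨fun hq y hy => hy.evalAt_eq_zero hq, fun hq => mem_of_symHom_mem_map _ ?_⟩
  have hn : 0 < n := Nat.pos_of_neZero n
  refine mem_of_forall_aeval_eq_zero (M := (n + k) * n) (by positivity) _ (fun i => ?_)
    fun y hy => hq y (isFusionPoint_of_evalAt_eq_zero fun g hg =>
      hy _ (Ideal.mem_map_of_mem _ hg))
  let J := (gepnerIdeal n k).map (symHom n)
  let x : Fin n → MvPolynomial (Fin n) ℂ ⧸ J := fun i => Ideal.Quotient.mk J (MvPolynomial.X i)
  have hmem : ∀ g ∈ gepnerIdeal n k, Ideal.Quotient.mk J (symHom n g) = 0 := fun g hg =>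
    Ideal.Quotient.eq_zero_iff_mem.2 (Ideal.mem_map_of_mem _ hg)
  have h1 : ∏ i, x i = 1 := by
    have h2 := hmem _ (Ideal.subset_span (Set.mem_insert _ _))
    have h3 : MvPolynomial.esymm (Fin n) ℂ n = ∏ i, MvPolynomial.X i := by
      have h4 : Finset.powersetCard n (Finset.univ : Finset (Fin n)) = {Finset.univ} := by
        simpa using Finset.powersetCard_self (Finset.univ : Finset (Fin n))
      rw [MvPolynomial.esymm, h4, Finset.sum_singleton]
    rwa [map_sub, map_one, symHom_e, h3, map_sub, map_one, sub_eq_zero, map_prod] at h2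
  have h2 : ∀ r : ℕ, k + 1 ≤ r → r + 1 ≤ n + k → hVal x r = 0 := fun r hr1 hr2 => by
    have h3 := hmem _ (Ideal.subset_span (Set.mem_insert_of_mem _ ⟨r, hr1, hr2, rfl⟩))
    rw [symHom_h, ← hVal_X, hVal_map] at h3
    exact h3
  rw [← Ideal.Quotient.eq_zero_iff_mem, map_sub, map_pow, map_one, sub_eq_zero]
  exact pow_mul_eq_one h2 h1 i

/-- When λ_1 - λ_n = k+1, the extreme entries of λ+ρ differ by n+k, so the alternant, and with it
s_λ, vanishes at every fusion point. -/
theorem goodmanWenzlIdeal_eq_gepnerIdeal (n k : ℕ) [NeZero n] :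
    goodmanWenzlIdeal n k = gepnerIdeal n k := by
  refine le_antisymm (Ideal.span_le.2 (Set.insert_subset
    (Ideal.subset_span (Set.mem_insert _ _)) ?_)) (gepnerIdeal_le_goodmanWenzlIdeal n k)
  rintro q ⟨lam, hl, hk, hq⟩
  rw [isSchur_iff hl] at hq
  subst hq
  rw [SetLike.mem_coe, mem_gepnerIdeal_iff]
  intro y hy
  rw [evalAt_schurE]
  refine (mul_eq_zero.1 ?_).resolve_right hy.alternant_rho_ne_zero
  rw [jacobiTrudi_mul_alternant, ← zAlternant_natCast]
  have h1 : (0 : Fin n) ≠ ⊤ := fun h => by rw [h] at hk; omega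
  refine hy.zAlternant_eq_zero_of_sub_eq h1 ?_
  have h2 : ((⊤ : Fin n) : ℕ) = n - 1 := rfl
  have hn : 0 < n := Nat.pos_of_neZero n
  simp only [addRho, h2, Fin.val_zero]
  omega

/-! ### The points given by the weights -/

/-- `exp (-2πi x / (n + k))`. -/
def expPoint (n k : ℕ) (x : ℂ) : ℂ := Complex.exp (-(2 * Real.pi * Complex.I / ((k : ℂ) + n)) * x)

theorem expPoint_add (n k : ℕ) (x x' : ℂ) :
    expPoint n k (x + x') = expPoint n k x * expPoint n k x' := by
  rw [expPoint, mul_add, Complex.exp_add]; rfl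

theorem expPoint_sum {ι : Type*} (n k : ℕ) (s : Finset ι) (x : ι → ℂ) :
    expPoint n k (∑ i ∈ s, x i) = ∏ i ∈ s, expPoint n k (x i) := by
  rw [expPoint, Finset.mul_sum, Complex.exp_sum]; rfl

theorem expPoint_mul_natCast (n k : ℕ) (x : ℂ) (a : ℕ) :
    expPoint n k (x * a) = expPoint n k x ^ a := by
  rw [expPoint, expPoint, ← Complex.exp_nat_mul]; congr 1; ring

theorem expPoint_ne_zero (n k : ℕ) (x : ℂ) : expPoint n k x ≠ 0 := Complex.exp_ne_zero _

theorem expPoint_zero (n k : ℕ) : expPoint n k 0 = 1 := by simp [expPoint]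

theorem expPoint_eq_one_iff {n k : ℕ} [NeZero n] (x : ℂ) :
    expPoint n k x = 1 ↔ ∃ z : ℤ, x = ((n + k : ℕ) : ℂ) * z := by
  have h0 : ((k : ℂ) + n) ≠ 0 := by
    have := Nat.pos_of_neZero n
    exact_mod_cast (by omega : k + n ≠ 0)
  have hpi : (2 * Real.pi * Complex.I : ℂ) ≠ 0 := Complex.two_pi_I_ne_zero
  rw [expPoint, Complex.exp_eq_one_iff]
  constructor
  · rintro ⟨z, hz⟩
    refine ⟨-z, mul_left_cancel₀ hpi ?_⟩
    field_simp at hz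
    push_cast
    linear_combination (-2 * Real.pi * Complex.I) * hz
  · rintro ⟨z, hz⟩
    refine ⟨-z, ?_⟩
    rw [hz]
    push_cast
    field_simp
    ring

theorem expPoint_eq_iff {n k : ℕ} [NeZero n] (x x' : ℂ) :
    expPoint n k x = expPoint n k x' ↔ ∃ z : ℤ, x - x' = ((n + k : ℕ) : ℂ) * z := by
  have h := expPoint_add n k (x - x') x'
  rw [sub_add_cancel] at h
  rw [← expPoint_eq_one_iff, h]
  exact mul_eq_right₀ (expPoint_ne_zero n k x')

theorem exists_expPoint_eq (n k : ℕ) [NeZero n] {y : ℂ} (hy : y ≠ 0) :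
    ∃ x, expPoint n k x = y := by
  have h0 : ((k : ℂ) + n) ≠ 0 := by
    have := Nat.pos_of_neZero n
    exact_mod_cast (by omega : k + n ≠ 0)
  have hpi : (2 * Real.pi * Complex.I : ℂ) ≠ 0 := Complex.two_pi_I_ne_zero
  refine ⟨-(Complex.log y * ((k : ℂ) + n) / (2 * Real.pi * Complex.I)), ?_⟩
  rw [expPoint]
  convert Complex.exp_log hy using 2
  have h1 : (Real.pi : ℂ) ≠ 0 := by exact_mod_cast Real.pi_ne_zero
  field_simp

theorem addRho_strictAnti {n : ℕ} {lam : Fin n → ℕ} (hl : Antitone lam) :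
    StrictAnti (addRho lam) := by
  intro i j hij
  have h1 : (i : ℕ) < j := hij
  have h2 := hl hij.le
  have := j.2
  simp only [addRho]
  omega

theorem Weight.addRho_lt {n k : ℕ} (m : Weight n k) (i : Fin n) : addRho m.part i < n + k := by
  have := m.part_le i
  have := i.2
  simp only [addRho]
  omega

theorem Weight.shifted_sub_shifted {n k : ℕ} (m : Weight n k) (i j : Fin n) :
    m.shifted i - m.shifted j = (addRho m.part i : ℝ) - addRho m.part j := by
  have hi := i.2
  have hj := j.2
  simp only [Weight.shifted, addRho]
  push_cast [Nat.cast_sub (show (i : ℕ) ≤ n - 1 by omega),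
    Nat.cast_sub (show (j : ℕ) ≤ n - 1 by omega)]
  ring

theorem Weight.sum_shifted {n k : ℕ} (m : Weight n k) : ∑ i, m.shifted i = 0 := by
  rcases n.eq_zero_or_pos with rfl | hn
  · simp
  have hn' : (n : ℝ) ≠ 0 := Nat.cast_ne_zero.2 hn.ne'
  have h1 : ∑ i : Fin n, ((i : ℕ) : ℝ) = n * (n - 1) / 2 := by
    rw [Fin.sum_univ_eq_sum_range (fun i => (i : ℝ)) n]
    have := Finset.sum_range_id_mul_two n
    have h2 := congrArg (Nat.cast : ℕ → ℝ) this
    push_cast [Nat.cast_sub (show 1 ≤ n from hn)] at h2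
    linarith
  simp only [Weight.shifted, Finset.sum_add_distrib, Finset.sum_sub_distrib, h1,
    Finset.sum_const, Finset.card_univ, Fintype.card_fin, nsmul_eq_mul]
  field_simp
  ring

/-- The point of the fusion variety given by a weight. -/
def Weight.point {n k : ℕ} (m : Weight n k) (i : Fin n) : ℂ := expPoint n k (m.shifted i)

theorem Weight.shifted_sub_eq_intCast {n k : ℕ} (m : Weight n k) (i j : Fin n) :
    m.shifted i - m.shifted j = (((addRho m.part i : ℤ) - addRho m.part j : ℤ) : ℝ) := by
  rw [m.shifted_sub_shifted]; push_cast; rfl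

theorem Weight.abs_sub_lt {n k : ℕ} (m : Weight n k) (i j : Fin n) :
    |(addRho m.part i : ℤ) - addRho m.part j| < (n + k : ℕ) := by
  have h1 := m.addRho_lt i
  have h2 := m.addRho_lt j
  rw [abs_lt]
  omega

/-- The coordinates of σ+ρ differ by nonzero integers smaller than n+k in absolute value and sum to
zero. -/
theorem Weight.isFusionPoint {n k : ℕ} [NeZero n] (m : Weight n k) : IsFusionPoint n k m.point := by
  refine ⟨fun i j hij => ?_, fun i j => ?_, ?_⟩
  · rw [Weight.point, Weight.point, expPoint_eq_iff] at hij
    obtain ⟨z, hz⟩ := hij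
    rw [← Complex.ofReal_sub, m.shifted_sub_eq_intCast] at hz
    have hz' : (addRho m.part i : ℤ) - addRho m.part j = (n + k : ℕ) * z := by exact_mod_cast hz
    have h1 := m.abs_sub_lt i j
    have h2 : (addRho m.part i : ℤ) - addRho m.part j = 0 :=
      Int.eq_zero_of_abs_lt_dvd ⟨z, hz'⟩ h1
    exact (addRho_strictAnti m.part_antitone).injective (by omega)
  · rw [Weight.point, Weight.point, ← expPoint_mul_natCast, ← expPoint_mul_natCast,
      expPoint_eq_iff]
    refine ⟨(addRho m.part i : ℤ) - addRho m.part j, ?_⟩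
    rw [← sub_mul, ← Complex.ofReal_sub, m.shifted_sub_eq_intCast, mul_comm]
    norm_cast
  · simp only [Weight.point]
    rw [← expPoint_sum, ← Complex.ofReal_sum, m.sum_shifted, Complex.ofReal_zero, expPoint_zero]

/-- The shifted weights differ by (n+k)z with Σz = 0. Each has spread below n+k, so z_i - z_j ≤ 1
and hence z = 0; a permutation matching two strictly decreasing sequences is the identity. -/
theorem Weight.eq_of_point_comp_perm {n k : ℕ} [NeZero n] {l m : Weight n k}
    (w : Equiv.Perm (Fin n)) (h : ∀ i, l.point i = m.point (w i)) : l = m := by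
  simp only [Weight.point, expPoint_eq_iff] at h
  choose z hz using h
  have hz' : ∀ i, l.shifted i - m.shifted (w i) = ((n + k : ℕ) : ℝ) * z i := fun i => by
    have := hz i
    exact_mod_cast this
  have hn : 0 < n := Nat.pos_of_neZero n
  have hN : ((n + k : ℕ) : ℝ) ≠ 0 := Nat.cast_ne_zero.2 (by omega)
  have hsum : ∑ i, z i = 0 := by
    have h1 : ∑ i, (l.shifted i - m.shifted (w i)) = 0 := by
      rw [Finset.sum_sub_distrib, Equiv.sum_comp w m.shifted, l.sum_shifted, m.sum_shifted,
        sub_zero]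
    simp only [hz', ← Finset.mul_sum] at h1
    exact_mod_cast (mul_eq_zero.1 h1).resolve_left hN
  have hle : ∀ i j, z i - z j ≤ 1 := fun i j => by
    have h1 : (addRho l.part i : ℤ) - addRho l.part j -
        ((addRho m.part (w i) : ℤ) - addRho m.part (w j)) = (n + k : ℕ) * (z i - z j) := by
      have h2 := hz' i
      have h3 := hz' j
      have h4 := l.shifted_sub_eq_intCast i j
      have h5 := m.shifted_sub_eq_intCast (w i) (w j)
      have h6 : (((addRho l.part i : ℤ) - addRho l.part j : ℤ) : ℝ) -
        (((addRho m.part (w i) : ℤ) - addRho m.part (w j) : ℤ) : ℝ) =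
          ((n + k : ℕ) : ℝ) * (z i - z j) := by
        rw [← h4, ← h5]; linear_combination h2 - h3
      exact_mod_cast h6
    have h2 := abs_lt.1 (l.abs_sub_lt i j)
    have h3 := abs_lt.1 (m.abs_sub_lt (w i) (w j))
    by_contra hlt
    have h4 : (2 : ℤ) ≤ z i - z j := by omega
    have h5 : ((n + k : ℕ) : ℤ) * 2 ≤ (n + k : ℕ) * (z i - z j) :=
      mul_le_mul_of_nonneg_left h4 (by positivity)
    omega
  have hz0 : ∀ i, z i = 0 := by
    by_contra hne
    push Not at hne
    obtain ⟨i, hi⟩ := hne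
    rcases lt_or_gt_of_ne hi with hi | hi
    · obtain ⟨j, -, hj⟩ := Finset.exists_pos_of_sum_zero_of_exists_nonzero z hsum
        ⟨i, Finset.mem_univ i, hi.ne⟩
      have := hle j i
      omega
    · obtain ⟨j, -, hj⟩ := Finset.exists_pos_of_sum_zero_of_exists_nonzero (fun i => -z i)
        (by rw [Finset.sum_neg_distrib, hsum, neg_zero]) ⟨i, Finset.mem_univ i, by simp [hi.ne']⟩
      have := hle i j
      omega
  have heq : ∀ i, l.shifted i = m.shifted (w i) := fun i => by
    have := hz' i
    rw [hz0, Int.cast_zero, mul_zero, sub_eq_zero] at this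
    exact this
  have hdiff : ∀ i j, (addRho l.part i : ℤ) - addRho l.part j =
      (addRho m.part (w i) : ℤ) - addRho m.part (w j) := fun i j => by
    have h4 := l.shifted_sub_eq_intCast i j
    have h5 := m.shifted_sub_eq_intCast (w i) (w j)
    rw [heq i, heq j, h5] at h4
    exact_mod_cast h4.symm
  have hw : StrictMono w := fun i j hij => by
    have h1 := addRho_strictAnti l.part_antitone hij
    have h2 := hdiff i j
    exact (addRho_strictAnti m.part_antitone).lt_iff_gt.1 (by omega)
  have hw1 : (w : Fin n → Fin n) = id :=
    (StrictMono.range_inj hw strictMono_id).1 (by rw [w.surjective.range_eq, Set.range_id])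
  refine Weight.part_injective (funext fun i => ?_)
  have h1 := hdiff i ⊤
  have h2 : ((⊤ : Fin n) : ℕ) = n - 1 := rfl
  rw [hw1] at h1
  simp only [id, addRho, h2, l.part_last ⊤ (by omega), m.part_last ⊤ (by omega)] at h1
  omega

/-- Every fusion point is, up to a permutation, the point of a weight. -/
theorem IsFusionPoint.exists_weight {n k : ℕ} [NeZero n] {y : Fin n → ℂ}
    (hy : IsFusionPoint n k y) :
    ∃ (m : Weight n k) (w : Equiv.Perm (Fin n)), ∀ i, y (w i) = m.point i := by
  have hn : 0 < n := Nat.pos_of_neZero n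
  have hNC : ((n + k : ℕ) : ℂ) ≠ 0 := Nat.cast_ne_zero.2 (by omega)
  obtain ⟨x, hx⟩ := exists_expPoint_eq n k (hy.ne_zero 0)
  have h1 : ∀ i, ∃ a : ℤ, y i = expPoint n k (x + a) := fun i => by
    obtain ⟨u, hu⟩ := exists_expPoint_eq n k (hy.ne_zero i)
    have h2 := hy.pow_eq i 0
    rw [← hu, ← hx, ← expPoint_mul_natCast, ← expPoint_mul_natCast, expPoint_eq_iff] at h2
    obtain ⟨a, ha⟩ := h2
    refine ⟨a, ?_⟩
    rw [← hu]
    congr 1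
    apply mul_left_cancel₀ hNC
    linear_combination ha
  choose a ha using h1
  have h2 : expPoint n k (∑ i, (x + a i)) = 1 := by
    rw [expPoint_sum, ← hy.prod_eq]
    exact Finset.prod_congr rfl fun i _ => (ha i).symm
  obtain ⟨z, hz⟩ := (expPoint_eq_one_iff _).1 h2
  -- Subtracting (n+k)z from one coordinate makes the exponents sum to zero without moving the
  -- point; the translation into the alcove preserves this.
  obtain ⟨q, hq, hle⟩ := exists_alcove (N := (n + k : ℕ)) (by exact_mod_cast (by omega))
    (fun i => a i - (n + k : ℕ) * (Pi.single 0 z : Fin n → ℤ) i)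
  let b : Fin n → ℤ := fun i =>
    a i - (n + k : ℕ) * (Pi.single 0 z : Fin n → ℤ) i + (n + k : ℕ) * q i
  have hyb : ∀ i, y i = expPoint n k (x + b i) := fun i => by
    rw [ha i, expPoint_eq_iff]
    refine ⟨(Pi.single 0 z : Fin n → ℤ) i - q i, ?_⟩
    simp only [b]
    push_cast
    ring
  have hsum : ∑ i, (x + (b i : ℂ)) = 0 := by
    have h3 : ∑ i, (x + (b i : ℂ)) = ∑ i, (x + (a i : ℂ)) -
        ((n + k : ℕ) : ℂ) * ((∑ i, (Pi.single 0 z : Fin n → ℤ) i : ℤ) : ℂ) +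
        ((n + k : ℕ) : ℂ) * ((∑ i, q i : ℤ) : ℂ) := by
      push_cast
      rw [Finset.mul_sum, Finset.mul_sum, ← Finset.sum_sub_distrib, ← Finset.sum_add_distrib]
      refine Finset.sum_congr rfl fun i _ => ?_
      simp only [b]
      push_cast
      ring
    rw [h3, hz, hq]
    simp
  have hb : ∀ i j, i ≠ j → ∀ t : ℤ, b i - b j ≠ (n + k : ℕ) * t := fun i j hij t ht => by
    refine hij (hy.injective ?_)
    rw [hyb, hyb, expPoint_eq_iff]
    refine ⟨t, ?_⟩
    rw [add_sub_add_left_eq_sub]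
    exact_mod_cast ht
  obtain ⟨w, hw⟩ := exists_perm_strictAnti (a := b) fun i j h => by
    by_contra hij
    exact hb i j hij 0 (by rw [h]; simp)
  obtain ⟨m, hm⟩ := exists_weight_of_strictAnti (k := k) hw (by
    have h2 : b (w 0) - b (w ⊤) ≤ (n + k : ℕ) := hle (w 0) (w ⊤)
    rcases eq_or_ne (w 0) (w ⊤) with h | h
    · rw [h, sub_self]; exact_mod_cast (by omega)
    · have h3 := hb _ _ h 1
      push_cast at h2 h3 ⊢
      omega)
  refine ⟨m, w, fun i => ?_⟩
  have h4 : ∀ i j, (x + b (w i)) - (x + b (w j)) = (m.shifted i : ℂ) - m.shifted j := fun i j => by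
    rw [← Complex.ofReal_sub, m.shifted_sub_eq_intCast, add_sub_add_left_eq_sub]
    have h5 := hm i
    have h6 := hm j
    rw [h5, h6]
    push_cast
    ring
  -- Both vectors have the same differences and coordinate sum zero, so they coincide.
  have h5 : x + b (w i) = m.shifted i := by
    have h7 : ∑ j, (m.shifted j : ℂ) = 0 := by
      rw [← Complex.ofReal_sum, m.sum_shifted, Complex.ofReal_zero]
    have h6 : ∑ j, ((x + (b (w i) : ℂ)) - (x + b (w j))) =
        ∑ j, ((m.shifted i : ℂ) - m.shifted j) := Finset.sum_congr rfl fun j _ => h4 i j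
    rw [Finset.sum_sub_distrib, Finset.sum_sub_distrib,
      Equiv.sum_comp w (fun j => x + (b j : ℂ)), hsum, h7] at h6
    simp only [Finset.sum_const, Finset.card_univ, Fintype.card_fin, nsmul_eq_mul,
      sub_zero] at h6
    exact mul_left_cancel₀ (Nat.cast_ne_zero.2 hn.ne') h6
  rw [hyb, h5]; rfl

theorem mem_gepnerIdeal_iff_forall_weight {n k : ℕ} [NeZero n] (q : ERing n) :
    q ∈ gepnerIdeal n k ↔ ∀ m : Weight n k, evalAt m.point q = 0 := by
  rw [mem_gepnerIdeal_iff]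
  refine ⟨fun h m => h _ m.isFusionPoint, fun h y hy => ?_⟩
  obtain ⟨m, w, hw⟩ := hy.exists_weight
  rw [← evalAt_comp_perm y w, funext hw, h]

/-- The values of the e_j determine the polynomial with roots y_i, hence the point up to
permutation. -/
theorem eq_of_forall_evalAt_eq {n k : ℕ} [NeZero n] {l m : Weight n k}
    (h : ∀ q, evalAt l.point q = evalAt m.point q) : l = m := by
  have h1 : ∀ y : Fin n → ℂ,
      ((Finset.univ.val.map y).map fun t => Polynomial.X - Polynomial.C t).prod
      = ∑ j ∈ Finset.range (n + 1), (-1) ^ j *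
        (Polynomial.C (evalAt y (e n j)) * Polynomial.X ^ (n - j)) := fun y => by
    rw [Multiset.prod_X_sub_X_eq_sum_esymm]
    simp only [Multiset.card_map, Finset.card_val, Finset.card_univ, Fintype.card_fin]
    refine Finset.sum_congr rfl fun j _ => ?_
    rw [evalAt_apply, symHom_e, MvPolynomial.aeval_esymm_eq_multiset_esymm]
  have h2 : Finset.univ.val.map l.point = Finset.univ.val.map m.point := by
    rw [← Polynomial.roots_multiset_prod_X_sub_C (Finset.univ.val.map l.point),
      ← Polynomial.roots_multiset_prod_X_sub_C (Finset.univ.val.map m.point), h1, h1]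
    simp only [h]
  have h3 : ∀ i, ∃ j, m.point j = l.point i := fun i => by
    have : l.point i ∈ Finset.univ.val.map m.point := by
      rw [← h2]
      exact Multiset.mem_map_of_mem _ (Finset.mem_univ i)
    simpa using this
  choose w hw using h3
  have hinj : Function.Injective w := fun i j hij =>
    l.isFusionPoint.injective (by rw [← hw, ← hw, hij])
  exact Weight.eq_of_point_comp_perm (Equiv.ofBijective w hinj.bijective_of_finite)
    fun i => (hw i).symm

/-! ### The `S`-matrix and the Verlinde formula -/

/-- Since σ+ρ has coordinate sum zero, a constant may be added to λ+ρ to make its entries natural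
numbers; the sum is then a Leibniz expansion. -/
theorem sum_sign_mul_exp_eq_alternant {n k : ℕ} (l s : Weight n k) :
    ∑ w : Equiv.Perm (Fin n), ((Equiv.Perm.sign w : ℤ) : ℂ) *
      Complex.exp (-(2 * Real.pi * Complex.I / ((k : ℂ) + n)) *
        ((∑ i, s.shifted i * l.shifted (w i) : ℝ) : ℂ)) = alternant s.point (addRho l.part) := by
  rw [alternant, Matrix.det_apply']
  refine Finset.sum_congr rfl fun w _ => ?_
  congr 1
  have h1 : ∑ i, s.shifted i * l.shifted (w i) =
      ∑ i, s.shifted i * (addRho l.part (w i) : ℝ) := by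
    rcases n.eq_zero_or_pos with rfl | hn
    · simp
    · have h2 : ∀ i, l.shifted (w i) = (addRho l.part (w i) : ℝ) +
          (l.shifted ⟨0, hn⟩ - addRho l.part ⟨0, hn⟩) := fun i => by
        linarith [l.shifted_sub_shifted (w i) ⟨0, hn⟩]
      simp only [h2, mul_add, Finset.sum_add_distrib, ← Finset.sum_mul, s.sum_shifted]
      simp
  rw [h1]
  change expPoint n k _ = _
  push_cast
  rw [expPoint_sum]
  refine Finset.prod_congr rfl fun i _ => ?_
  rw [expPoint_mul_natCast]; rfl

theorem exists_modS_eq (n k : ℕ) [NeZero n] : ∃ c : ℂ, c ≠ 0 ∧ ∀ l s : Weight n k,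
    modS n k l s = c * alternant s.point (addRho l.part) := by
  refine ⟨_, div_ne_zero (Complex.exp_ne_zero _) ?_, fun l s => by
    rw [modS, sum_sign_mul_exp_eq_alternant]⟩
  have hn : (0 : ℝ) < n := Nat.cast_pos.2 (Nat.pos_of_neZero n)
  rw [Complex.ofReal_ne_zero, Real.sqrt_ne_zero']
  positivity

theorem modS_comm {n k : ℕ} (l s : Weight n k) : modS n k l s = modS n k s l := by
  rw [modS, modS]
  congr 1
  refine Fintype.sum_equiv (Equiv.inv _) _ _ fun w => ?_
  rw [Equiv.inv_apply, Equiv.Perm.sign_inv]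
  congr 4
  rw [← Equiv.sum_comp w⁻¹]
  refine Finset.sum_congr rfl fun i _ => ?_
  simp [mul_comm]

/-- The values of the Schur polynomials of the weights at the points of the weights. -/
def schurMatrix (n k : ℕ) : Matrix (Weight n k) (Weight n k) ℂ := fun l s =>
  jacobiTrudi l.part s.point

theorem modS_vac_ne_zero {n k : ℕ} [NeZero n] (s : Weight n k) :
    modS n k (Weight.vac n k) s ≠ 0 := by
  obtain ⟨c, hc, h⟩ := exists_modS_eq n k
  rw [h, Weight.part_vac]
  exact mul_ne_zero hc s.isFusionPoint.alternant_rho_ne_zero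

theorem modS_eq {n k : ℕ} [NeZero n] (l s : Weight n k) :
    modS n k l s = schurMatrix n k l s * modS n k (Weight.vac n k) s := by
  obtain ⟨c, hc, h⟩ := exists_modS_eq n k
  rw [h, h, Weight.part_vac, schurMatrix, mul_left_comm, jacobiTrudi_mul_alternant]

theorem schurMatrix_vac {n k : ℕ} [NeZero n] (s : Weight n k) :
    schurMatrix n k (Weight.vac n k) s = 1 := by
  rw [schurMatrix, Weight.part_vac, jacobiTrudi_zero]

/-- Points of distinct weights are separated by `ERing n`; products of separating elements give the
delta functions. -/
theorem exists_evalAt_eq {n k : ℕ} [NeZero n] (g : Weight n k → ℂ) :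
    ∃ q : ERing n, ∀ m : Weight n k, evalAt m.point q = g m := by
  have h1 : ∀ l m : Weight n k, ∃ q : ERing n, l ≠ m →
      evalAt l.point q = 1 ∧ evalAt m.point q = 0 := by
    intro l m
    by_cases h : l = m
    · exact ⟨0, fun h' => absurd h h'⟩
    · obtain ⟨q, hq⟩ := not_forall.1 (mt eq_of_forall_evalAt_eq h)
      have hC : ∀ (y : Fin n → ℂ) (a : ℂ), evalAt y (MvPolynomial.C a) = a := fun y a =>
        (evalAt y).commutes a
      refine ⟨MvPolynomial.C (evalAt l.point q - evalAt m.point q)⁻¹ *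
        (q - MvPolynomial.C (evalAt m.point q)), fun _ => ⟨?_, ?_⟩⟩
      · rw [map_mul, map_sub, hC, hC, inv_mul_cancel₀ (sub_ne_zero.2 hq)]
      · rw [map_mul, map_sub, hC, hC, sub_self, mul_zero]
  choose q hq using h1
  refine ⟨∑ l, g l • ∏ m ∈ Finset.univ.erase l, q l m, fun m => ?_⟩
  rw [map_sum, Finset.sum_eq_single m]
  · rw [map_smul, map_prod, Finset.prod_eq_one, smul_eq_mul, mul_one]
    intro l hl
    exact (hq m l (Finset.ne_of_mem_erase hl).symm).1
  · intro l _ hl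
    rw [map_smul, map_prod, Finset.prod_eq_zero (Finset.mem_erase.2 ⟨hl.symm, Finset.mem_univ m⟩)
      (hq l m hl).2, smul_zero]
  · simp

/-- Each delta function is the restriction of a symmetric polynomial, hence a combination of the
rows; the coefficients form a left inverse. -/
theorem isUnit_schurMatrix (n k : ℕ) [NeZero n] : IsUnit (schurMatrix n k) := by
  have h1 : ∀ s : Weight n k, ∃ c : Weight n k → ℂ, ∀ t : Weight n k,
      ∑ m, c m * schurMatrix n k m t = if s = t then 1 else 0 := by
    intro s
    obtain ⟨q, hq⟩ := exists_evalAt_eq (fun t => if s = t then (1 : ℂ) else 0)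
    obtain ⟨c, -, hc⟩ := exists_aeval_eq_sum n k ⊤ (symHom_isSymmetric q) (fun _ => trivial)
    exact ⟨c, fun t => by rw [← hq t, evalAt_apply, hc _ t.isFusionPoint]; rfl⟩
  choose c hc using h1
  rw [Matrix.isUnit_iff_isUnit_det]
  refine Matrix.isUnit_det_of_left_inverse (B := Matrix.of c) ?_
  ext s t
  rw [Matrix.mul_apply, Matrix.one_apply]
  exact hc s t

theorem modS_eq_mul_diagonal (n k : ℕ) [NeZero n] : modS n k = schurMatrix n k *
    Matrix.diagonal (modS n k (Weight.vac n k)) := by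
  ext l s
  rw [Matrix.mul_diagonal, modS_eq]

theorem modS_mul_inv (n k : ℕ) [NeZero n] : modS n k * (modS n k)⁻¹ = 1 := by
  apply Matrix.mul_nonsing_inv
  rw [modS_eq_mul_diagonal, Matrix.det_mul, Matrix.det_diagonal]
  exact ((Matrix.isUnit_iff_isUnit_det _).1 (isUnit_schurMatrix n k)).mul
    (Finset.prod_ne_zero_iff.2 fun s _ => modS_vac_ne_zero s).isUnit

/-- The Verlinde formula has the indices of the inverse in transposed order, which is harmless
because S is symmetric. -/
theorem sum_modS_mul_inv {n k : ℕ} [NeZero n] (l r : Weight n k) :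
    ∑ s, modS n k l s * (modS n k)⁻¹ r s = if l = r then 1 else 0 := by
  have h1 : (modS n k).transpose = modS n k := by ext l s; exact modS_comm s l
  have h2 : (modS n k)⁻¹.transpose = (modS n k)⁻¹ := by rw [Matrix.transpose_nonsing_inv, h1]
  have h3 : ∀ s, (modS n k)⁻¹ r s = (modS n k)⁻¹ s r := fun s => by
    conv_lhs => rw [← h2]
    rfl
  simp only [h3]
  rw [← Matrix.mul_apply, modS_mul_inv, Matrix.one_apply]

/-- The quotient S_{lσ} S_{mσ} / S_{∅σ} equals s_l s_m S_{∅σ} = Σ_t c_t S_{tσ}, and contraction with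
the inverse of S extracts c_r. -/
theorem verlinde_eq_of_schurMatrix_mul {n k : ℕ} [NeZero n] {l m : Weight n k} {c : Weight n k → ℂ}
    (hc : ∀ s, schurMatrix n k l s * schurMatrix n k m s = ∑ r, c r * schurMatrix n k r s)
    (r : Weight n k) : verlinde n k l m r = c r := by
  have h1 : ∀ s, modS n k l s * modS n k m s * (modS n k)⁻¹ r s / modS n k (Weight.vac n k) s =
      ∑ t, c t * (modS n k t s * (modS n k)⁻¹ r s) := by
    intro s
    have h0 := modS_vac_ne_zero s
    rw [div_eq_iff h0, modS_eq l, modS_eq m]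
    have h2 := hc s
    calc _ = schurMatrix n k l s * schurMatrix n k m s * modS n k (Weight.vac n k) s *
          modS n k (Weight.vac n k) s * (modS n k)⁻¹ r s := by ring
      _ = _ := by
        rw [h2]
        simp only [Finset.sum_mul]
        refine Finset.sum_congr rfl fun t _ => ?_
        rw [modS_eq t s]
        ring
  rw [verlinde, Finset.sum_congr rfl fun s _ => h1 s, Finset.sum_comm]
  simp only [← Finset.mul_sum, sum_modS_mul_inv]
  simp

theorem fusionCoeff_eq_verlinde {n k : ℕ} [NeZero n] (l m r : Weight n k) :
    (fusionCoeff n k l m r : ℂ) = verlinde n k l m r := by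
  obtain ⟨c, hc⟩ := exists_int_schur_mul n k l m
  rw [fusionCoeff, verlinde_eq_of_schurMatrix_mul (c := fun r => (c r : ℂ))
    fun s => hc s.point s.isFusionPoint]
  simp

theorem schurMatrix_mul {n k : ℕ} [NeZero n] (l m s : Weight n k) :
    schurMatrix n k l s * schurMatrix n k m s =
      ∑ r, (fusionCoeff n k l m r : ℂ) * schurMatrix n k r s := by
  obtain ⟨c, hc⟩ := exists_int_schur_mul n k l m
  have h : ∀ s, schurMatrix n k l s * schurMatrix n k m s =
      ∑ r, (c r : ℂ) * schurMatrix n k r s := fun s => hc s.point s.isFusionPoint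
  simp only [fusionCoeff_eq_verlinde, verlinde_eq_of_schurMatrix_mul h]
  exact h s

/-! ### The fusion ring -/

namespace FusionRing

variable {n k : ℕ}

/-- The basis of the weights. -/
def basis (n k : ℕ) : Module.Basis (Weight n k) ℤ (FusionRing n k) :=
  Module.Basis.ofRepr (AddEquiv.toIntLinearEquiv (AddEquiv.refl (Weight n k →₀ ℤ)) :
    FusionRing n k ≃ₗ[ℤ] (Weight n k →₀ ℤ))

theorem basis_apply (m : Weight n k) : basis n k m = of m := rfl

/-- The values of an element of the fusion ring at the points of the weights. -/
def eval (n k : ℕ) : FusionRing n k →ₗ[ℤ] (Weight n k → ℂ) :=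
  (basis n k).constr ℤ fun m => schurMatrix n k m

theorem eval_of (m : Weight n k) : eval n k (of m) = schurMatrix n k m := by
  rw [← basis_apply, eval, Module.Basis.constr_basis]

theorem eval_eq_sum (x : FusionRing n k) : eval n k x = ∑ m, x.coeff m • schurMatrix n k m := by
  rw [eval, Module.Basis.constr_apply_fintype]
  rfl

theorem eval_mul [NeZero n] (x y : FusionRing n k) :
    eval n k (x * y) = eval n k x * eval n k y := by
  rw [eval_eq_sum x, eval_eq_sum y, Finset.sum_mul_sum]
  change eval n k (mul x y) = _
  rw [mul]
  simp only [map_sum, map_smul, eval_of]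
  refine Finset.sum_congr rfl fun l _ => Finset.sum_congr rfl fun m _ => ?_
  ext s
  have h := schurMatrix_mul l m s
  have hz : ∀ (z : ℤ) (f : Weight n k → ℂ), (z • f) s = z * f s := fun z f => zsmul_eq_mul _ _
  simp only [Finset.sum_apply, Pi.mul_apply, hz]
  rw [mul_mul_mul_comm, h, Finset.mul_sum]
  refine Finset.sum_congr rfl fun r _ => ?_
  push_cast
  ring

theorem eval_one [NeZero n] : eval n k 1 = 1 := by
  change eval n k (of (Weight.vac n k)) = 1
  rw [eval_of]
  ext s
  exact schurMatrix_vac s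

/-- The rows of `schurMatrix` are independent over ℂ. Injectivity lets the ring axioms be checked on
functions with pointwise product. -/
theorem eval_injective [NeZero n] : Function.Injective (eval n k) := by
  intro x y h
  have hli : LinearIndependent ℂ (schurMatrix n k).row :=
    Matrix.linearIndependent_rows_of_isUnit (isUnit_schurMatrix n k)
  rw [eval_eq_sum, eval_eq_sum] at h
  have h1 : ∑ m, ((x.coeff m : ℂ) - y.coeff m) • schurMatrix n k m = 0 := by
    simp only [sub_smul, Finset.sum_sub_distrib]
    rw [sub_eq_zero]
    simpa only [Int.cast_smul_eq_zsmul] using h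
  have h2 := Fintype.linearIndependent_iff.1 hli _ h1
  refine (basis n k).repr.injective (Finsupp.ext fun m => ?_)
  have := sub_eq_zero.1 (h2 m)
  exact_mod_cast this

/-- The complexified fusion ring as the ring of functions on the weights. -/
def evalEquiv (n k : ℕ) [NeZero n] : (ℂ ⊗[ℤ] FusionRing n k) ≃ₗ[ℂ] (Weight n k → ℂ) :=
  (Algebra.TensorProduct.basis ℂ (basis n k)).equiv
    (basisOfLinearIndependentOfCardEqFinrank' (schurMatrix n k).row
      (Matrix.linearIndependent_rows_of_isUnit (isUnit_schurMatrix n k)) (by simp)) (Equiv.refl _)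

theorem evalEquiv_tmul [NeZero n] (a : ℂ) (x : FusionRing n k) :
    evalEquiv n k (a ⊗ₜ[ℤ] x) = a • eval n k x := by
  have h1 : ∀ m, evalEquiv n k (1 ⊗ₜ[ℤ] of m) = eval n k (of m) := fun m => by
    rw [← basis_apply, ← Algebra.TensorProduct.basis_apply, evalEquiv, Module.Basis.equiv_apply,
      basis_apply, eval_of]
    simp
    rfl
  have h2 : ((evalEquiv n k).toLinearMap.restrictScalars ℤ).comp
      (TensorProduct.mk ℤ ℂ (FusionRing n k) 1) = eval n k :=
    (basis n k).ext fun m => h1 m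
  have h3 : a ⊗ₜ[ℤ] x = a • ((1 : ℂ) ⊗ₜ[ℤ] x) := by
    rw [TensorProduct.smul_tmul', smul_eq_mul, mul_one]
  rw [h3, map_smul, ← h2]
  rfl

theorem evalEquiv_mul [NeZero n] (x y : ℂ ⊗[ℤ] FusionRing n k) :
    evalEquiv n k (x * y) = evalEquiv n k x * evalEquiv n k y := by
  induction x using TensorProduct.induction_on with
  | zero =>
    rw [Algebra.TensorProduct.instNonUnitalNonAssocSemiring.zero_mul y, map_zero, zero_mul]
  | add x x' hx hx' => 
    rw [Algebra.TensorProduct.instNonUnitalNonAssocSemiring.right_distrib x x' y, map_add, map_add,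
      add_mul, hx, hx']
  | tmul a u =>
    induction y using TensorProduct.induction_on with
    | zero =>
      rw [Algebra.TensorProduct.instNonUnitalNonAssocSemiring.mul_zero (a ⊗ₜ[ℤ] u), map_zero,
        mul_zero]
    | add y y' hy hy' => 
      rw [Algebra.TensorProduct.instNonUnitalNonAssocSemiring.left_distrib (a ⊗ₜ[ℤ] u) y y',
        map_add, map_add, mul_add, hy, hy']
    | tmul b v =>
      rw [Algebra.TensorProduct.tmul_mul_tmul, evalEquiv_tmul, evalEquiv_tmul, evalEquiv_tmul,
        eval_mul, smul_mul_smul_comm]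

end FusionRing

/-- Evaluation at the points of the weights. -/
def evalHom (n k : ℕ) : ERing n →ₐ[ℂ] (Weight n k → ℂ) :=
  AlgHom.pi fun m : Weight n k => evalAt m.point

theorem evalHom_surjective (n k : ℕ) [NeZero n] : Function.Surjective (evalHom n k) := fun g => by
  obtain ⟨q, hq⟩ := exists_evalAt_eq g
  exact ⟨q, funext hq⟩

theorem ker_evalHom (n k : ℕ) [NeZero n] : RingHom.ker (evalHom n k) = gepnerIdeal n k := by
  ext q
  rw [RingHom.mem_ker, mem_gepnerIdeal_iff_forall_weight, funext_iff]
  rfl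

/-- The quotient by the ideal as the ring of functions on the weights. -/
def quotientEquiv (n k : ℕ) [NeZero n] :
    (ERing n ⧸ gepnerIdeal n k) ≃ₐ[ℂ] (Weight n k → ℂ) :=
  (Ideal.quotientEquivAlgOfEq ℂ (ker_evalHom n k).symm).trans
    (Ideal.quotientKerAlgEquivOfSurjective (evalHom_surjective n k))

theorem quotientEquiv_mk {n k : ℕ} [NeZero n] (q : ERing n) :
    quotientEquiv n k (Ideal.Quotient.mk (gepnerIdeal n k) q) = evalHom n k q := rfl

end SuFusion
end

theorem mainTheorem5 (n k : ℕ) [NeZero n] :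
    -- the ideal of Gepner's fusion potential is `⟨e_n - 1, h_{k+1}, …, h_{n+k-1}⟩`
    SuFusion.potentialIdeal n k = SuFusion.gepnerIdeal n k ∧
    -- it coincides with the ideal of Goodman and Wenzl
    SuFusion.goodmanWenzlIdeal n k = SuFusion.gepnerIdeal n k ∧
    -- the Verlinde formula has integer values, and these make the fusion product
    -- a unital, commutative and associative ring structure
    (∀ l m r : SuFusion.Weight n k,
      (SuFusion.fusionCoeff n k l m r : ℂ) = SuFusion.verlinde n k l m r) ∧
    (∀ x y z : SuFusion.FusionRing n k, x * y * z = x * (y * z)) ∧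
    (∀ x y : SuFusion.FusionRing n k, x * y = y * x) ∧
    (∀ x : SuFusion.FusionRing n k, 1 * x = x) ∧
    -- `λ ↦ s_λ + I_{n,k}` gives an isomorphism of algebras
    ∃ φ : (ℂ ⊗[ℤ] SuFusion.FusionRing n k) ≃ₗ[ℂ] (SuFusion.ERing n ⧸ SuFusion.gepnerIdeal n k),
      (∀ x y, φ (x * y) = φ x * φ y) ∧
      φ (1 ⊗ₜ[ℤ] (1 : SuFusion.FusionRing n k)) = 1 ∧
      ∀ m : SuFusion.Weight n k, ∃ q : SuFusion.ERing n,
        SuFusion.IsSchur m.part q ∧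
        φ (1 ⊗ₜ[ℤ] SuFusion.FusionRing.of m) =
          Ideal.Quotient.mk (SuFusion.gepnerIdeal n k) q := by
  open SuFusion in
  refine ⟨potentialIdeal_eq_gepnerIdeal n k, goodmanWenzlIdeal_eq_gepnerIdeal n k,
    fusionCoeff_eq_verlinde, fun x y z => FusionRing.eval_injective ?_,
    fun x y => FusionRing.eval_injective ?_, fun x => FusionRing.eval_injective ?_,
    (FusionRing.evalEquiv n k).trans (quotientEquiv n k).symm.toLinearEquiv, fun x y => ?_, ?_,
    fun m => ⟨schurE m.part, (isSchur_iff m.part_antitone _).2 rfl, ?_⟩⟩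
  · simp only [FusionRing.eval_mul, mul_assoc]
  · simp only [FusionRing.eval_mul, mul_comm]
  · rw [FusionRing.eval_mul, FusionRing.eval_one, one_mul]
  · change (quotientEquiv n k).symm (FusionRing.evalEquiv n k (x * y)) = _
    rw [FusionRing.evalEquiv_mul, map_mul]
    rfl
  · change (quotientEquiv n k).symm (FusionRing.evalEquiv n k _) = _
    rw [FusionRing.evalEquiv_tmul, FusionRing.eval_one, one_smul, map_one]
  · change (quotientEquiv n k).symm (FusionRing.evalEquiv n k _) = _
    rw [AlgEquiv.symm_apply_eq, quotientEquiv_mk, FusionRing.evalEquiv_tmul, one_smul,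
      FusionRing.eval_of]
    ext s
    exact (evalAt_schurE s.point m.part).symm
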